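/- A Pisot number is a real algebraic integer $\beta>1$ all of whose conjugates over $\mathbb{Q}$ other than $\beta$ itself have absolute value less than $1$. A Salem number is a real algebraic integer $\beta>1$ all of whose conjugates over $\mathbb{Q}$ other than $\beta$ itself have absolute value at most $1$, with at least one conjugate of absolute value exactly $1$. Let $\beta$ be a Pisot or Salem number. Then the two series \[ \sum_{m=1}^{\infty}\beta^{-\lfloor m^{\log m}\rfloor} \qquad\text{and}\qquad \sum_{m=3}^{\infty}\beta^{-\lfloor m^{\log\log m}\rfloor} \] (where $\log$ is the natural logarithm) converge, and their sums are algebraically independent over $\mathbb{Q}$. -/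

import Mathlib

/-- A Pisot number: a real algebraic integer greater than `1` all of whose conjugates (in `ℂ`, over
`ℚ`) other than itself have modulus less than `1`. -/
def IsPisotNumber (β : ℝ) : Prop :=
  IsIntegral ℤ β ∧ 1 < β ∧ ∀ z : ℂ, IsConjRoot ℚ (β : ℂ) z → z ≠ (β : ℂ) → ‖z‖ < 1

/-- A Salem number: a real algebraic integer greater than `1` all of whose conjugates (in `ℂ`, over
`ℚ`) other than itself have modulus at most `1`, at least one of them having modulus exactly `1`. -/
def IsSalemNumber (β : ℝ) : Prop :=
  IsIntegral ℤ β ∧ 1 < β ∧ (∀ z : ℂ, IsConjRoot ℚ (β : ℂ) z → z ≠ (β : ℂ) → ‖z‖ ≤ 1) ∧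
    ∃ z : ℂ, IsConjRoot ℚ (β : ℂ) z ∧ ‖z‖ = 1

/-- The term `β ^ (-⌊m ^ (log m)⌋)`. -/
noncomputable def logTerm (β : ℝ) (m : ℕ) : ℝ :=
  β ^ (-⌊(m : ℝ) ^ Real.log m⌋)

/-- The term `β ^ (-⌊m ^ (log log m)⌋)`. -/
noncomputable def logLogTerm (β : ℝ) (m : ℕ) : ℝ :=
  β ^ (-⌊(m : ℝ) ^ Real.log (Real.log m)⌋)

/-! Put x = 1/β and let f, g be the series 1 + ∑ X^(s m) attached to the two exponent sequences
(`logFloor` and `logLogFloor`). An algebraic relation between the sums gives a nonzero integer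
polynomial P vanishing at (f(x), g(x)); the coefficients c_n of P(f, g) are integers of polynomial
growth with ∑ c_n x^n = 0.

By the norm inequality, a truncation ∑_{n ≤ R} c_n β^(R-n) is either zero or at least an inverse
power of R, up to a constant. A run of zero coefficients after R, longer than a large multiple of
log R, makes the truncation too small to be nonzero. It cannot vanish either if the coefficients
after R keep one sign for long and are not all zero early on, since the tail is too small to cancel
them. This is `exists_coeff_ne_zero_of_sign`.

`aeval_ne_zero_of_sparse` finds a place where both happen. Let X^(I+1) Y^(J+1) be the leading
monomial, Y-degree first. The exponents coming from lower Y-degree are so few that they leave gaps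
longer than the spacing of the exponents of g^(J+1). Inside such a gap, follow an exponent t of f^I
g^(J+1) by a stretch free of further ones: there only the leading monomial contributes, so the sign
is constant. As f has an exponent a in every interval [y, 2y] with y large, c_(t+a) ≠ 0 while
sparseness leaves a run of zeros before t + a.

`exists_scale` supplies the sizes: up to N ≈ K^(log log K), g has at most K exponents and f only
K^o(1), while greedy sums of J + 1 exponents of g come within O(N K^(1/4-(J+1))) of every number up
to N. -/

/-! ### The norm inequality -/

open Finset in
/-- The norm inequality: a nonzero integer polynomial in a Pisot or Salem number cannot be small. -/
theorem exists_one_le_abs_sum_mul_pow {β : ℝ} (hint : IsIntegral ℤ β)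
    (hconj : ∀ z : ℂ, IsConjRoot ℚ (β : ℂ) z → z ≠ (β : ℂ) → ‖z‖ ≤ 1) :
    ∃ d : ℕ, ∀ (R : ℕ) (c : ℕ → ℤ), ∑ n ∈ range (R + 1), (c n : ℝ) * β ^ (R - n) ≠ 0 →
      1 ≤ |∑ n ∈ range (R + 1), (c n : ℝ) * β ^ (R - n)| *
        (∑ n ∈ range (R + 1), |(c n : ℝ)|) ^ d := by
  classical
  have hintC : IsIntegral ℤ (β : ℂ) := by
    have := hint.map (Complex.ofRealHom.toIntAlgHom)
    simpa using this
  have hintQ : IsIntegral ℚ (β : ℂ) := hintC.tower_top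
  let K := IntermediateField.adjoin ℚ {(β : ℂ)}
  have : FiniteDimensional ℚ K := IntermediateField.adjoin.finiteDimensional hintQ
  let γ : K := IntermediateField.AdjoinSimple.gen ℚ (β : ℂ)
  have hγint : IsIntegral ℤ γ := by
    have h := (isIntegral_algHom_iff (K.val.restrictScalars ℤ) K.val.injective (x := γ)).1
    exact h hintC
  -- Each embedding other than the inclusion sends `γ` into the closed unit disc, so it contributes
  -- at most ∑ |c n| to the norm; `d` counts these embeddings.
  refine ⟨(univ.erase K.val : Finset (K →ₐ[ℚ] ℂ)).card, fun R c hne ↦ ?_⟩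
  set y : ℝ := ∑ n ∈ range (R + 1), (c n : ℝ) * β ^ (R - n) with hy
  let x : K := ∑ n ∈ range (R + 1), (c n : K) * γ ^ (R - n)
  have hσ : ∀ σ : K →ₐ[ℚ] ℂ, σ x = ∑ n ∈ range (R + 1), (c n : ℂ) * (σ γ) ^ (R - n) := by
    intro σ
    simp [x, map_sum]
  have hx0 : K.val x = (y : ℂ) := by
    refine (hσ K.val).trans ?_
    rw [hy]
    push_cast
    rfl
  have hxne : x ≠ 0 := by
    rintro h
    rw [h, map_zero] at hx0
    exact hne (by exact_mod_cast hx0.symm)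
  have hxint : IsIntegral ℤ x := by
    refine IsIntegral.sum _ fun n _ ↦ ?_
    exact (isIntegral_algebraMap (R := ℤ) (A := K) (x := c n)).mul (hγint.pow _)
  obtain ⟨m, hm⟩ : ∃ m : ℤ, (m : ℚ) = Algebra.norm ℚ x := by
    have := Algebra.isIntegral_norm ℚ hxint
    obtain ⟨m, hm⟩ := IsIntegrallyClosed.isIntegral_iff.1 this
    exact ⟨m, by simpa using hm⟩
  have hm0 : m ≠ 0 := by
    rintro rfl
    rw [Int.cast_zero] at hm
    exact hxne (Algebra.norm_eq_zero_iff.1 hm.symm)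
  have hprod := Algebra.norm_eq_prod_embeddings ℚ ℂ x
  rw [← hm] at hprod
  have h1 : (1 : ℝ) ≤ ∏ σ : K →ₐ[ℚ] ℂ, ‖σ x‖ := by
    rw [← norm_prod, ← hprod]
    have : (1 : ℝ) ≤ |(m : ℝ)| := by exact_mod_cast Int.one_le_abs hm0
    simpa using this
  rw [← mul_prod_erase univ (fun σ : K →ₐ[ℚ] ℂ ↦ ‖σ x‖) (mem_univ K.val)] at h1
  change 1 ≤ ‖K.val x‖ * _ at h1
  rw [hx0, Complex.norm_real, Real.norm_eq_abs] at h1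
  refine h1.trans ?_
  gcongr
  rw [← prod_const]
  refine prod_le_prod (fun _ _ ↦ norm_nonneg _) fun σ hσm ↦ ?_
  have hσγ : ‖σ γ‖ ≤ 1 := by
    refine hconj _ ?_ ?_
    · rw [isConjRoot_def, minpoly.algHom_eq σ σ.injective γ]
      exact (minpoly.algHom_eq K.val K.val.injective γ)
    · intro h
      refine (mem_erase.1 hσm).1 ?_
      refine (IntermediateField.adjoin.powerBasis hintQ).algHom_ext ?_
      rw [IntermediateField.adjoin.powerBasis_gen]
      exact h
  rw [hσ]
  refine (norm_sum_le _ _).trans (sum_le_sum fun n _ ↦ ?_)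
  rw [norm_mul, norm_pow, Complex.norm_intCast]
  exact mul_le_of_le_one_right (abs_nonneg _) (pow_le_one₀ (norm_nonneg _) hσγ)

/-! ### Partial sums and supports of power series over ℕ -/

open Finset in
/-- The sum of the coefficients of `f` of index at most `N`. -/
noncomputable def partialSum (f : PowerSeries ℕ) (N : ℕ) : ℕ :=
  ∑ n ∈ range (N + 1), PowerSeries.coeff n f

-- Pairs with sum at most `N` lie in the square [0, N]². Submultiplicativity is what bounds both the
-- coefficients and the number of exponents of f^i g^j.
open Finset in
theorem partialSum_mul_le (f g : PowerSeries ℕ) (N : ℕ) :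
    partialSum (f * g) N ≤ partialSum f N * partialSum g N := by
  unfold partialSum
  rw [sum_mul_sum, ← sum_product']
  set s := ((range (N + 1)) ×ˢ (range (N + 1))).filter (fun p : ℕ × ℕ ↦ p.1 + p.2 ∈ range (N + 1))
    with hs
  refine le_trans (le_of_eq ?_) (sum_le_sum_of_subset (filter_subset _ _ : s ⊆ _))
  rw [← sum_fiberwise_of_maps_to (s := s) (t := range (N + 1)) (g := fun p ↦ p.1 + p.2)
    (fun p hp ↦ (mem_filter.1 hp).2)]
  refine sum_congr rfl fun n hn ↦ ?_
  rw [PowerSeries.coeff_mul]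
  refine sum_congr ?_ fun _ _ ↦ rfl
  ext ⟨a, b⟩
  simp only [hs, HasAntidiagonal.mem_antidiagonal, mem_filter, mem_product, mem_range] at hn ⊢
  omega

theorem partialSum_one (N : ℕ) : partialSum 1 N = 1 := by
  simp [partialSum, PowerSeries.coeff_one]

theorem partialSum_pow_le (f : PowerSeries ℕ) (i N : ℕ) :
    partialSum (f ^ i) N ≤ partialSum f N ^ i := by
  induction i with
  | zero => simp [partialSum_one]
  | succ i ih =>
    rw [pow_succ, pow_succ]
    exact (partialSum_mul_le _ _ _).trans (Nat.mul_le_mul_right _ ih)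

theorem partialSum_pow_mul_pow_le (f g : PowerSeries ℕ) (i j N : ℕ) :
    partialSum (f ^ i * g ^ j) N ≤ partialSum f N ^ i * partialSum g N ^ j :=
  (partialSum_mul_le _ _ _).trans
    (Nat.mul_le_mul (partialSum_pow_le _ _ _) (partialSum_pow_le _ _ _))

theorem coeff_le_partialSum (f : PowerSeries ℕ) (n : ℕ) :
    PowerSeries.coeff n f ≤ partialSum f n :=
  Finset.single_le_sum (f := fun n ↦ PowerSeries.coeff n f) (fun _ _ ↦ Nat.zero_le _)
    (Finset.self_mem_range_succ n)

open Finset in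
/-- The number of indices at most `N` in the support is bounded by the partial sum. -/
theorem card_support_le_partialSum (f : PowerSeries ℕ) (N : ℕ) :
    ((range (N + 1)).filter (fun n ↦ PowerSeries.coeff n f ≠ 0)).card ≤ partialSum f N := by
  rw [card_eq_sum_ones, partialSum]
  refine (sum_le_sum fun n hn ↦ ?_).trans (sum_le_sum_of_subset (filter_subset _ _))
  exact Nat.one_le_iff_ne_zero.2 (mem_filter.1 hn).2

theorem coeff_mul_coeff_le (f g : PowerSeries ℕ) (a b : ℕ) :
    PowerSeries.coeff a f * PowerSeries.coeff b g ≤ PowerSeries.coeff (a + b) (f * g) := by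
  rw [PowerSeries.coeff_mul]
  exact Finset.single_le_sum
    (f := fun p : ℕ × ℕ ↦ PowerSeries.coeff p.1 f * PowerSeries.coeff p.2 g)
    (fun _ _ ↦ Nat.zero_le _) (a := (a, b)) (Finset.HasAntidiagonal.mem_antidiagonal.2 rfl)

theorem coeff_add_mul_ne_zero {f g : PowerSeries ℕ} {a b : ℕ} (ha : PowerSeries.coeff a f ≠ 0)
    (hb : PowerSeries.coeff b g ≠ 0) : PowerSeries.coeff (a + b) (f * g) ≠ 0 := by
  have := coeff_mul_coeff_le f g a b
  have := Nat.mul_pos (Nat.pos_of_ne_zero ha) (Nat.pos_of_ne_zero hb)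
  omega

theorem coeff_zero_pow_ne_zero {f : PowerSeries ℕ} (hf : PowerSeries.coeff 0 f ≠ 0) (i : ℕ) :
    PowerSeries.coeff 0 (f ^ i) ≠ 0 := by
  rw [PowerSeries.coeff_zero_eq_constantCoeff_apply] at *
  rw [map_pow]
  exact pow_ne_zero _ hf

theorem coeff_le_coeff_mul {f g : PowerSeries ℕ} (hg : PowerSeries.coeff 0 g ≠ 0) (n : ℕ) :
    PowerSeries.coeff n f ≤ PowerSeries.coeff n (f * g) :=
  (Nat.le_mul_of_pos_right _ (Nat.pos_of_ne_zero hg)).trans (coeff_mul_coeff_le f g n 0)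

/-- A nonzero constant term makes multiplication by `f` or `g` only enlarge coefficients, so the
supports of f^i g^j are nested. One product thus dominates a whole family of monomials. -/
theorem coeff_pow_mul_pow_mono {f g : PowerSeries ℕ} (hf : PowerSeries.coeff 0 f ≠ 0)
    (hg : PowerSeries.coeff 0 g ≠ 0) {i i' j j' : ℕ} (hi : i ≤ i') (hj : j ≤ j') (n : ℕ) :
    PowerSeries.coeff n (f ^ i * g ^ j) ≤ PowerSeries.coeff n (f ^ i' * g ^ j') := by
  obtain ⟨k, rfl⟩ := Nat.exists_eq_add_of_le hi
  obtain ⟨l, rfl⟩ := Nat.exists_eq_add_of_le hj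
  have h : f ^ (i + k) * g ^ (j + l) = f ^ i * g ^ j * f ^ k * g ^ l := by ring
  rw [h]
  exact (coeff_le_coeff_mul (coeff_zero_pow_ne_zero hf k) n).trans
    (coeff_le_coeff_mul (coeff_zero_pow_ne_zero hg l) n)

/-! ### Evaluation at a real point, and counting series -/

theorem hasSum_coeff_mul {f g : PowerSeries ℕ} {x a b : ℝ} (hx : 0 ≤ x)
    (hf : HasSum (fun n ↦ ((PowerSeries.coeff n f : ℕ) : ℝ) * x ^ n) a)
    (hg : HasSum (fun n ↦ ((PowerSeries.coeff n g : ℕ) : ℝ) * x ^ n) b) :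
    HasSum (fun n ↦ ((PowerSeries.coeff n (f * g) : ℕ) : ℝ) * x ^ n) (a * b) := by
  have hn : ∀ (h : PowerSeries ℕ),
      (fun n ↦ ‖((PowerSeries.coeff n h : ℕ) : ℝ) * x ^ n‖) =
        fun n ↦ ((PowerSeries.coeff n h : ℕ) : ℝ) * x ^ n := fun h ↦ by
    ext n
    exact Real.norm_of_nonneg (by positivity)
  have hfn : Summable fun n ↦ ‖((PowerSeries.coeff n f : ℕ) : ℝ) * x ^ n‖ := by
    rw [hn]; exact hf.summable
  have hgn : Summable fun n ↦ ‖((PowerSeries.coeff n g : ℕ) : ℝ) * x ^ n‖ := by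
    rw [hn]; exact hg.summable
  have h1 := summable_norm_sum_mul_antidiagonal_of_summable_norm hfn hgn
  have h2 := tsum_mul_tsum_eq_tsum_sum_antidiagonal_of_summable_norm hfn hgn
  rw [hf.tsum_eq, hg.tsum_eq] at h2
  rw [h2]
  refine (h1.of_norm.hasSum).congr_fun ?_
  intro n
  rw [PowerSeries.coeff_mul]
  push_cast
  rw [Finset.sum_mul]
  refine Finset.sum_congr rfl fun p hp ↦ ?_
  rw [← Finset.HasAntidiagonal.mem_antidiagonal.1 hp, pow_add]
  ring

theorem hasSum_coeff_pow {f : PowerSeries ℕ} {x a : ℝ} (hx : 0 ≤ x)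
    (hf : HasSum (fun n ↦ ((PowerSeries.coeff n f : ℕ) : ℝ) * x ^ n) a) (i : ℕ) :
    HasSum (fun n ↦ ((PowerSeries.coeff n (f ^ i) : ℕ) : ℝ) * x ^ n) (a ^ i) := by
  induction i with
  | zero =>
    rw [pow_zero, pow_zero]
    convert hasSum_ite_eq 0 (1 : ℝ) using 2 with n
    rcases eq_or_ne n 0 with rfl | h <;> simp [PowerSeries.coeff_one, *]
  | succ i ih =>
    rw [pow_succ, pow_succ]
    exact hasSum_coeff_mul hx ih hf

/-- The series `1 + ∑ X ^ (s m)`, for a sequence `s` tending to infinity. -/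
noncomputable def countSeries (s : ℕ → ℕ) : PowerSeries ℕ :=
  PowerSeries.mk fun n ↦ (if n = 0 then 1 else 0) + Nat.card {m // s m = n}

theorem coeff_zero_countSeries_ne_zero (s : ℕ → ℕ) :
    PowerSeries.coeff 0 (countSeries s) ≠ 0 := by
  simp [countSeries]

/-- `Nat.card` is 0 on an infinite type, so `countSeries` counts correctly only when the fibres are
finite. -/
theorem finite_fiber {s : ℕ → ℕ} {c : ℕ} (hs : ∀ m, m ≤ s m + c) (n : ℕ) :
    Finite {m // s m = n} :=
  Set.Finite.subset (Set.finite_Iic (n + c)) fun m (hm : s m = n) ↦ by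
    have := hs m
    simp only [Set.mem_Iic]
    omega

theorem coeff_countSeries_ne_zero {s : ℕ → ℕ} {c : ℕ} (hs : ∀ m, m ≤ s m + c) (m : ℕ) :
    PowerSeries.coeff (s m) (countSeries s) ≠ 0 := by
  have := finite_fiber hs (s m)
  have : Nonempty {k // s k = s m} := ⟨⟨m, rfl⟩⟩
  have := Nat.card_pos (α := {k // s k = s m})
  simp only [countSeries, PowerSeries.coeff_mk]
  omega

open Finset in
theorem partialSum_countSeries_le {s : ℕ → ℕ} {N M : ℕ}
    (hM : ∀ m, s m ≤ N → m < M) : partialSum (countSeries s) N ≤ M + 1 := by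
  have h : ∀ n ∈ range (N + 1), Nat.card {m // s m = n} =
      (((range M).filter (fun m ↦ s m ≤ N)).filter (fun m ↦ s m = n)).card := fun n hn ↦ by
    refine Nat.subtype_card _ fun m ↦ ?_
    rw [mem_range] at hn
    simp only [mem_filter, mem_range]
    exact ⟨fun h ↦ h.2, fun h ↦ ⟨⟨hM m (by omega), by omega⟩, h⟩⟩
  unfold partialSum countSeries
  simp only [PowerSeries.coeff_mk, sum_add_distrib]
  rw [sum_congr rfl h, ← card_eq_sum_card_fiberwise (fun m hm ↦ by simp_all)]
  have h1 := card_filter_le (range M) (fun m ↦ s m ≤ N)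
  rw [card_range] at h1
  simp
  omega

theorem hasSum_countSeries {s : ℕ → ℕ} {c : ℕ} (hs : ∀ m, m ≤ s m + c) {x : ℝ} (hx : 0 ≤ x)
    (hx1 : x < 1) :
    Summable (fun m ↦ x ^ s m) ∧
      HasSum (fun n ↦ ((PowerSeries.coeff n (countSeries s) : ℕ) : ℝ) * x ^ n) (1 + ∑' m, x ^ s m) := by
  have hsum : Summable (fun m ↦ x ^ s m) := by
    rcases hx.eq_or_lt with rfl | hpos
    · refine summable_of_ne_finset_zero (s := Finset.range (c + 1)) fun m hm ↦ ?_
      have := hs m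
      rw [Finset.mem_range] at hm
      exact zero_pow (by omega)
    · refine Summable.of_nonneg_of_le (fun m ↦ by positivity) (fun m ↦ ?_)
        ((summable_geometric_of_lt_one hx hx1).mul_left (x ^ c)⁻¹)
      rw [inv_mul_eq_div, le_div_iff₀ (by positivity), ← pow_add]
      exact pow_le_pow_of_le_one hx hx1.le (hs m)
  refine ⟨hsum, ?_⟩
  -- Grouping the indices by the value of `s` turns the sum over m into the power series.
  have h1 := hsum.hasSum.tsum_fiberwise s
  have h2 := (hasSum_ite_eq 0 (1 : ℝ)).add h1
  refine h2.congr_fun ?_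
  intro n
  have h3 : ∑' m : s ⁻¹' {n}, x ^ s m = ((Nat.card {m // s m = n} : ℕ) : ℝ) * x ^ n := by
    have := finite_fiber hs n
    rw [tsum_congr (fun m : s ⁻¹' {n} ↦ show x ^ s m = x ^ n by rw [m.2]), tsum_const,
      nsmul_eq_mul]
    rfl
  rw [h3, countSeries, PowerSeries.coeff_mk]
  push_cast
  rcases eq_or_ne n 0 with rfl | h <;> simp [*]

/-! ### Tails, signs and runs of zeros -/

/-- The tail of a power series with polynomially bounded coefficients. -/
theorem exists_abs_tsum_tail_le {x : ℝ} (hx : 0 < x) (hx1 : x < 1) {c : ℕ → ℝ} {H : ℝ} {E : ℕ}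
    (hc : ∀ n, |c n| ≤ H * (n + 1) ^ E) :
    ∃ C : ℝ, 0 < C ∧ ∀ M : ℕ, |∑' n, c (n + M) * x ^ (n + M)| ≤ C * (M + 1) ^ E * x ^ M := by
  have hH : 0 ≤ H := by
    have := (abs_nonneg _).trans (hc 0)
    simpa using this
  have hs : Summable fun n : ℕ ↦ ((n : ℝ) + 1) ^ E * x ^ n := by
    have h := summable_pow_mul_geometric_of_norm_lt_one (R := ℝ) E (r := x)
      (by rwa [Real.norm_of_nonneg hx.le])
    have h2 := ((summable_nat_add_iff 1).2 h).mul_left x⁻¹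
    refine h2.congr fun n ↦ ?_
    push_cast
    field_simp
    ring
  set S := ∑' n : ℕ, ((n : ℝ) + 1) ^ E * x ^ n with hS
  have hS0 : 0 ≤ S := tsum_nonneg fun n ↦ by positivity
  refine ⟨H * S + 1, by positivity, fun M ↦ ?_⟩
  have hb : ∀ n : ℕ, ‖c (n + M) * x ^ (n + M)‖ ≤
      H * (M + 1) ^ E * x ^ M * ((n + 1) ^ E * x ^ n) := fun n ↦ by
    rw [norm_mul, Real.norm_eq_abs, Real.norm_of_nonneg (pow_nonneg hx.le _), pow_add]
    -- The inequality n + M + 1 ≤ (M + 1)(n + 1) separates the dependence on M from the convergent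
    -- sum over n.
    have h1 : ((n + M : ℕ) + 1 : ℝ) ^ E ≤ ((M + 1) * (n + 1)) ^ E := by
      push_cast
      gcongr
      nlinarith [(Nat.cast_nonneg n : (0 : ℝ) ≤ n), (Nat.cast_nonneg M : (0 : ℝ) ≤ M)]
    calc |c (n + M)| * (x ^ n * x ^ M) ≤ H * ((M + 1) * (n + 1)) ^ E * (x ^ n * x ^ M) := by
          gcongr
          exact (hc _).trans (by gcongr)
      _ = _ := by rw [mul_pow]; ring
  have := tsum_of_norm_bounded (hs.hasSum.mul_left (H * (M + 1) ^ E * x ^ M)) hb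
  rw [Real.norm_eq_abs] at this
  refine this.trans ?_
  rw [← hS]
  have : (0 : ℝ) ≤ (M + 1) ^ E * x ^ M := by positivity
  nlinarith

open Finset in
/-- If a power series with polynomially bounded integer coefficients vanishes at the inverse of a
number with the norm inequality, then a long stretch of coefficients of one sign cannot be
preceded by a long stretch of zeros. -/
theorem exists_coeff_ne_zero_of_sign {β : ℝ} (hβ : 1 < β) {d : ℕ}
    (hd : ∀ (R : ℕ) (c : ℕ → ℤ), ∑ n ∈ range (R + 1), (c n : ℝ) * β ^ (R - n) ≠ 0 →
      1 ≤ |∑ n ∈ range (R + 1), (c n : ℝ) * β ^ (R - n)| *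
        (∑ n ∈ range (R + 1), |(c n : ℝ)|) ^ d)
    {c : ℕ → ℤ} {H : ℝ} {E : ℕ} (hc : ∀ n, |(c n : ℝ)| ≤ H * (n + 1) ^ E)
    (h0 : HasSum (fun n ↦ (c n : ℝ) * β⁻¹ ^ n) 0) :
    ∃ E₀ : ℕ, ∀ (t p q N W : ℕ) (a : ℤ), p < q → q ≤ N + 1 →
      (∀ n, t < n → n < q → 0 ≤ a * c n) → a * c p ≠ 0 → E₀ * ((N : ℝ) + 2) ^ E₀ ≤ β ^ W →
      p + W ≤ q → ∀ R, t ≤ R → R < p → R + W ≤ N → ∃ n, R < n ∧ n ≤ R + W ∧ c n ≠ 0 := by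
  have hβ0 : 0 < β := by positivity
  set x := β⁻¹ with hx
  have hx0 : 0 < x := by positivity
  have hx1 : x < 1 := inv_lt_one_of_one_lt₀ hβ
  obtain ⟨C, hC0, hC⟩ := exists_abs_tsum_tail_le hx0 hx1 hc
  have hH : 0 ≤ H := by
    have := (abs_nonneg _).trans (hc 0)
    simpa using this
  have hsplit : ∀ M, ∑ n ∈ range M, (c n : ℝ) * x ^ n = -∑' n, (c (n + M) : ℝ) * x ^ (n + M) := by
    intro M
    have := h0.summable.sum_add_tsum_nat_add M
    rw [h0.tsum_eq] at this
    linarith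
  -- `C` is beaten when excluding a zero truncation, C (H + 1)^d when applying the norm inequality;
  -- E + (E + 1) d is the power of N + 2 arising there.
  obtain ⟨E₀, hE₀⟩ : ∃ E₀ : ℕ, C * (H + 1) ^ d + C < E₀ ∧ E + (E + 1) * d ≤ E₀ := by
    obtain ⟨k, hk⟩ := exists_nat_gt (C * (H + 1) ^ d + C)
    refine ⟨max k (E + (E + 1) * d), hk.trans_le (by exact_mod_cast le_max_left _ _),
      le_max_right _ _⟩
  refine ⟨E₀, fun t p q N W a hpq hqN hsign hap hW hpW R htR hRp hRW ↦ ?_⟩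
  have hN2 : (1 : ℝ) ≤ (N : ℝ) + 2 := by linarith [(Nat.cast_nonneg N : (0 : ℝ) ≤ N)]
  have hCd : 0 ≤ C * (H + 1) ^ d := by positivity
  have hxβ : ∀ n, x ^ n * β ^ n = 1 := fun n ↦ by
    rw [← mul_pow, hx, inv_mul_cancel₀ hβ0.ne', one_pow]
  have hy : ∑ n ∈ range (R + 1), (c n : ℝ) * β ^ (R - n) =
      β ^ R * ∑ n ∈ range (R + 1), (c n : ℝ) * x ^ n := by
    rw [mul_sum]
    refine sum_congr rfl fun n hn ↦ ?_
    have hnR : n ≤ R := Nat.lt_succ_iff.1 (mem_range.1 hn)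
    have : β ^ R = β ^ (R - n) * β ^ n := by rw [← pow_add, Nat.sub_add_cancel hnR]
    rw [this]
    linear_combination (-(c n : ℝ) * β ^ (R - n)) * hxβ n
  -- If the truncation vanished, the terms from R + 1 to q - 1 would cancel the tail from q. Having
  -- one sign, they sum to at least x^p in modulus, while the tail has order q^E x^q with q ≥ p + W.
  have hyne : ∑ n ∈ range (R + 1), (c n : ℝ) * β ^ (R - n) ≠ 0 := by
    intro hy0
    rw [hy] at hy0
    have hz := (mul_eq_zero.1 hy0).resolve_left (by positivity)
    have h1 : ∑ n ∈ Ico (R + 1) q, (c n : ℝ) * x ^ n =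
        -∑' n, (c (n + q) : ℝ) * x ^ (n + q) := by
      rw [sum_Ico_eq_sub _ (by omega), hz, sub_zero, hsplit]
    have hp : p ∈ Ico (R + 1) q := mem_Ico.2 ⟨hRp, hpq⟩
    have ha : (a : ℝ) ≠ 0 := by
      have := left_ne_zero_of_mul hap
      exact_mod_cast this
    have hcp : (1 : ℝ) ≤ |(c p : ℝ)| := by
      exact_mod_cast Int.one_le_abs (right_ne_zero_of_mul hap)
    have h2 : |(a : ℝ)| * x ^ p ≤ |(a : ℝ)| * |∑ n ∈ Ico (R + 1) q, (c n : ℝ) * x ^ n| := by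
      rw [← abs_mul, mul_sum]
      have h3 : (a : ℝ) * (c p * x ^ p) ≤ ∑ n ∈ Ico (R + 1) q, (a : ℝ) * (c n * x ^ n) := by
        refine single_le_sum (f := fun n ↦ (a : ℝ) * (c n * x ^ n)) (fun n hn ↦ ?_) hp
        rw [mem_Ico] at hn
        have : (0 : ℝ) ≤ (a * c n : ℤ) := by exact_mod_cast hsign n (by omega) hn.2
        push_cast at this
        have := mul_nonneg this (pow_nonneg hx0.le n)
        linarith
      have h4 : (a : ℝ) * (c p * x ^ p) = |(a : ℝ)| * |(c p : ℝ)| * x ^ p := by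
        have : (0 : ℝ) ≤ (a * c p : ℤ) := by exact_mod_cast hsign p (by omega) hpq
        push_cast at this
        rw [← abs_mul, abs_of_nonneg this]
        ring
      refine le_trans ?_ (h3.trans (le_abs_self _))
      rw [h4]
      have : 0 ≤ |(a : ℝ)| * x ^ p := by positivity
      nlinarith
    have h5 := le_of_mul_le_mul_left h2 (abs_pos.2 ha)
    rw [h1, abs_neg] at h5
    have h6 := h5.trans (hC q)
    have h7 : β ^ W ≤ C * (q + 1) ^ E := by
      obtain ⟨k, rfl⟩ := Nat.exists_eq_add_of_le hpW
      rw [pow_add x (p + W) k, pow_add x p W] at h6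
      have h8 : x ^ k ≤ 1 := pow_le_one₀ hx0.le hx1.le
      have h9 : x ^ p * 1 ≤ x ^ p * (C * ((p + W + k : ℕ) + 1) ^ E * x ^ W * x ^ k) := by linarith
      have h10 := le_of_mul_le_mul_left h9 (by positivity)
      have h11 : 1 ≤ C * ((p + W + k : ℕ) + 1) ^ E * x ^ W := by
        refine h10.trans (mul_le_of_le_one_right (by positivity) h8)
      calc β ^ W = 1 * β ^ W := (one_mul _).symm
        _ ≤ C * ((p + W + k : ℕ) + 1) ^ E * x ^ W * β ^ W := by gcongr
        _ = _ := by rw [mul_assoc, hxβ, mul_one]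
    have h12 : C * ((q : ℝ) + 1) ^ E ≤ C * ((N : ℝ) + 2) ^ E₀ := by
      have : (q : ℝ) + 1 ≤ (N : ℝ) + 2 := by
        have : (q : ℝ) ≤ (N : ℝ) + 1 := by exact_mod_cast hqN
        linarith
      gcongr
      refine (pow_le_pow_left₀ (by positivity) this E).trans (pow_le_pow_right₀ hN2 ?_)
      exact le_trans (Nat.le_add_right _ _) hE₀.2
    have h13 : C * ((N : ℝ) + 2) ^ E₀ < E₀ * ((N : ℝ) + 2) ^ E₀ := by
      have : C < E₀ := by linarith [hE₀.1]
      gcongr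
    linarith
  -- Without nonzero coefficients in (R, R + W], the truncation is β^R times a tail starting at R +
  -- W + 1, too small for the norm inequality.
  by_contra! hcon
  have h1 := hd R c hyne
  have h2 : ∑ n ∈ range (R + 1), (c n : ℝ) * x ^ n =
      -∑' n, (c (n + (R + W + 1)) : ℝ) * x ^ (n + (R + W + 1)) := by
    rw [← hsplit]
    refine sum_subset (range_subset_range.2 (by omega)) fun n hn hn' ↦ ?_
    rw [mem_range] at hn hn'
    rw [hcon n (by omega) (by omega)]
    simp
  have h3 : |∑ n ∈ range (R + 1), (c n : ℝ) * β ^ (R - n)| ≤ C * ((N : ℝ) + 2) ^ E * x ^ W := by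
    rw [hy, h2, mul_neg, abs_neg, abs_mul, abs_of_nonneg (by positivity)]
    calc β ^ R * |∑' n, (c (n + (R + W + 1)) : ℝ) * x ^ (n + (R + W + 1))|
        ≤ β ^ R * (C * ((R + W + 1 : ℕ) + 1) ^ E * x ^ (R + W + 1)) := by
          gcongr
          exact hC _
      _ = C * ((R + W + 1 : ℕ) + 1) ^ E * x ^ W * x * (x ^ R * β ^ R) := by ring
      _ ≤ C * ((N : ℝ) + 2) ^ E * x ^ W * 1 * 1 := by
          rw [hxβ]
          have : ((R + W + 1 : ℕ) : ℝ) + 1 ≤ (N : ℝ) + 2 := by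
            have : ((R + W : ℕ) : ℝ) ≤ N := by exact_mod_cast hRW
            push_cast at this ⊢
            linarith
          gcongr
      _ = _ := by ring
  have h4 : ∑ n ∈ range (R + 1), |(c n : ℝ)| ≤ (H + 1) * ((N : ℝ) + 2) ^ (E + 1) := by
    calc ∑ n ∈ range (R + 1), |(c n : ℝ)| ≤ ∑ n ∈ range (R + 1), H * ((N : ℝ) + 2) ^ E := by
          refine sum_le_sum fun n hn ↦ (hc n).trans ?_
          have : (n : ℝ) + 1 ≤ (N : ℝ) + 2 := by
            have : n ≤ N := by rw [mem_range] at hn; omega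
            have : (n : ℝ) ≤ N := by exact_mod_cast this
            linarith
          gcongr
      _ = ((R : ℝ) + 1) * (H * ((N : ℝ) + 2) ^ E) := by simp
      _ ≤ ((N : ℝ) + 2) * ((H + 1) * ((N : ℝ) + 2) ^ E) := by
          have : (R : ℝ) ≤ N := by exact_mod_cast (by omega : R ≤ N)
          gcongr
          · linarith
          · linarith
      _ = _ := by ring
  have h5 : 1 ≤ C * (H + 1) ^ d * ((N : ℝ) + 2) ^ E₀ * x ^ W := by
    calc (1 : ℝ) ≤ (C * ((N : ℝ) + 2) ^ E * x ^ W) * ((H + 1) * ((N : ℝ) + 2) ^ (E + 1)) ^ d := by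
          refine h1.trans ?_
          have : 0 ≤ ∑ n ∈ range (R + 1), |(c n : ℝ)| := sum_nonneg fun _ _ ↦ abs_nonneg _
          gcongr
      _ = C * (H + 1) ^ d * ((N : ℝ) + 2) ^ (E + (E + 1) * d) * x ^ W := by
          rw [mul_pow, ← pow_mul, pow_add]
          ring
      _ ≤ _ := by
          gcongr
          exact hE₀.2
  have h6 : β ^ W ≤ C * (H + 1) ^ d * ((N : ℝ) + 2) ^ E₀ := by
    calc β ^ W = 1 * β ^ W := (one_mul _).symm
      _ ≤ C * (H + 1) ^ d * ((N : ℝ) + 2) ^ E₀ * x ^ W * β ^ W := by gcongr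
      _ = _ := by rw [mul_assoc, hxβ, mul_one]
  have h7 : C * (H + 1) ^ d * ((N : ℝ) + 2) ^ E₀ < E₀ * ((N : ℝ) + 2) ^ E₀ := by
    have : C * (H + 1) ^ d < E₀ := by linarith [hE₀.1]
    gcongr
  linarith

/-! ### The combinatorial core -/

/-- Among `k` consecutive windows, one is free of a given set with fewer than `k` elements. -/
theorem exists_window_free (S : Finset ℕ) (x W k : ℕ) (h : S.card < k) :
    ∃ j < k, ∀ n ∈ S, x + j * W < n → x + j * W + W < n := by
  by_contra! hcon
  choose! φ hφ using hcon
  -- The windows (x + jW, x + (j+1)W] are disjoint, so by pigeonhole they cannot each contain a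
  -- point of `S`.
  obtain ⟨i, hi, j, hj, hij, he⟩ := Finset.exists_ne_map_eq_of_card_lt_of_maps_to
    (s := Finset.range k) (t := S) (by simpa using h) (f := φ)
    (fun i hi ↦ (hφ i (Finset.mem_range.1 hi)).1)
  have h1 := (hφ i (Finset.mem_range.1 hi)).2
  have h2 := (hφ j (Finset.mem_range.1 hj)).2
  rw [he] at h1
  rcases lt_or_gt_of_ne hij with h3 | h3
  · have := Nat.mul_le_mul_right W h3
    rw [Nat.succ_mul] at this
    omega
  · have := Nat.mul_le_mul_right W h3
    rw [Nat.succ_mul] at this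
    omega

open Finset in
/-- The combinatorial heart: an integer polynomial all of whose monomials are divisible by `X Y`
has no zero at the values of two very sparse power series, one much sparser than the other. -/
theorem aeval_ne_zero_of_sparse {β : ℝ} (hβ : 1 < β) {d : ℕ}
    (hd : ∀ (R : ℕ) (c : ℕ → ℤ), ∑ n ∈ range (R + 1), (c n : ℝ) * β ^ (R - n) ≠ 0 →
      1 ≤ |∑ n ∈ range (R + 1), (c n : ℝ) * β ^ (R - n)| *
        (∑ n ∈ range (R + 1), |(c n : ℝ)|) ^ d)
    {f g : PowerSeries ℕ} (hf0 : PowerSeries.coeff 0 f ≠ 0) (hg0 : PowerSeries.coeff 0 g ≠ 0)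
    {C : ℕ} (hfC : ∀ n, partialSum f n ≤ C * (n + 1)) (hgC : ∀ n, partialSum g n ≤ C * (n + 1))
    {ξ : Fin 2 → ℝ}
    (hfξ : HasSum (fun n ↦ ((PowerSeries.coeff n f : ℕ) : ℝ) * β⁻¹ ^ n) (ξ 0))
    (hgξ : HasSum (fun n ↦ ((PowerSeries.coeff n g : ℕ) : ℝ) * β⁻¹ ^ n) (ξ 1))
    (hfgap : ∃ y₀ : ℕ, ∀ y ≥ y₀, ∃ a, PowerSeries.coeff a f ≠ 0 ∧ y ≤ a ∧ a ≤ 2 * y)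
    (hscale : ∀ J E : ℕ, ∃ K N G : ℕ, partialSum f N ≤ K ∧ partialSum g N ≤ K ∧ E ≤ K ∧
      K ^ E ≤ G ∧ E * G * partialSum f N ^ E * K ^ J ≤ N ∧ E * ((N : ℝ) + 2) ^ E ≤ β ^ K ∧
      ∀ x ≤ N, ∃ t, PowerSeries.coeff t (g ^ (J + 1)) ≠ 0 ∧ t ≤ x ∧ x ≤ t + G)
    {P : MvPolynomial (Fin 2) ℤ} (hP : P ≠ 0) (hP1 : ∀ e ∈ P.support, 1 ≤ e 0 ∧ 1 ≤ e 1) :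
    MvPolynomial.aeval ξ P ≠ 0 := by
  intro hPξ
  have hx0 : (0 : ℝ) ≤ β⁻¹ := by positivity
  -- the leading monomial, in the lexicographic order with the second variable first
  obtain ⟨e, heP, he⟩ : ∃ e ∈ P.support, ∀ e' ∈ P.support, e' ≠ e →
      e' 1 < e 1 ∨ (e' 1 = e 1 ∧ e' 0 < e 0) := by
    obtain ⟨e, heP, he⟩ := exists_max_image P.support (fun e ↦ toLex (e 1, e 0))
      (MvPolynomial.support_nonempty.2 hP)
    refine ⟨e, heP, fun e' he' hne ↦ ?_⟩
    have h := he e' he'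
    rw [Prod.Lex.toLex_le_toLex] at h
    refine h.imp id fun h ↦ ⟨h.1, lt_of_le_of_ne h.2 fun h0 ↦ hne ?_⟩
    ext i
    fin_cases i
    · exact h0
    · exact h.1
  obtain ⟨I, hI⟩ : ∃ I, e 0 = I + 1 := ⟨e 0 - 1, by have := (hP1 e heP).1; omega⟩
  obtain ⟨J, hJ⟩ : ∃ J, e 1 = J + 1 := ⟨e 1 - 1, by have := (hP1 e heP).2; omega⟩
  set D := P.support.sup (fun e ↦ e 0) with hD
  have hDle : ∀ e' ∈ P.support, e' 0 ≤ D := fun e' he' ↦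
    le_sup (f := fun e : Fin 2 →₀ ℕ ↦ e 0) he'
  have hJle : ∀ e' ∈ P.support, e' 1 ≤ J + 1 := fun e' he' ↦ by
    rcases eq_or_ne e' e with rfl | h
    · omega
    · rcases he e' he' h with h | h <;> omega
  have hID : I + 1 ≤ D := hI ▸ hDle e heP
  let ρ : (Fin 2 →₀ ℕ) → ℕ → ℕ := fun e n ↦ PowerSeries.coeff n (f ^ e 0 * g ^ e 1)
  let c : ℕ → ℤ := fun n ↦ ∑ e ∈ P.support, P.coeff e * ρ e n
  let h : PowerSeries ℕ := f ^ D * g ^ (J + 1)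
  have hρh : ∀ e' ∈ P.support, ∀ n, ρ e' n ≤ PowerSeries.coeff n h := fun e' he' n ↦
    coeff_pow_mul_pow_mono hf0 hg0 (hDle e' he') (hJle e' he') n
  have hsum : HasSum (fun n ↦ (c n : ℝ) * β⁻¹ ^ n) 0 := by
    have h1 : HasSum (fun n ↦ ∑ e ∈ P.support, ((P.coeff e : ℤ) : ℝ) * ((ρ e n : ℝ) * β⁻¹ ^ n))
        (∑ e ∈ P.support, ((P.coeff e : ℤ) : ℝ) * (ξ 0 ^ e 0 * ξ 1 ^ e 1)) :=
      hasSum_sum fun e _ ↦ (hasSum_coeff_mul hx0 (hasSum_coeff_pow hx0 hfξ _)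
        (hasSum_coeff_pow hx0 hgξ _)).mul_left _
    rw [MvPolynomial.aeval_eq_eval₂Hom, MvPolynomial.coe_eval₂Hom,
      MvPolynomial.eval₂_eq'] at hPξ
    simp only [Fin.prod_univ_two, algebraMap_int_eq, eq_intCast] at hPξ
    rw [hPξ] at h1
    refine h1.congr_fun fun n ↦ ?_
    simp only [c]
    push_cast
    rw [sum_mul]
    exact sum_congr rfl fun _ _ ↦ by ring
  have hcH : ∀ n, |(c n : ℝ)| ≤ ((∑ e ∈ P.support, |((P.coeff e : ℤ) : ℝ)|) * C ^ (D + (J + 1))) *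
      ((n : ℝ) + 1) ^ (D + (J + 1)) := fun n ↦ by
    have h1 : PowerSeries.coeff n h ≤ (C * (n + 1)) ^ (D + (J + 1)) :=
      (coeff_le_partialSum h n).trans <| (partialSum_pow_mul_pow_le _ _ _ _ _).trans <| by
        rw [pow_add _ D]
        exact Nat.mul_le_mul (Nat.pow_le_pow_left (hfC n) _) (Nat.pow_le_pow_left (hgC n) _)
    have h2 : |(c n : ℝ)| ≤ ∑ e ∈ P.support, |((P.coeff e : ℤ) : ℝ)| * (C * (n + 1)) ^ (D + (J + 1)) := by
      simp only [c]
      push_cast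
      refine (abs_sum_le_sum_abs _ _).trans (sum_le_sum fun e' he' ↦ ?_)
      rw [abs_mul, Nat.abs_cast]
      gcongr
      exact_mod_cast (hρh e' he' n).trans h1
    rw [← sum_mul, mul_pow] at h2
    linarith
  obtain ⟨E₀, hE₀⟩ := exists_coeff_ne_zero_of_sign hβ hd hcH hsum
  obtain ⟨y₀, hy₀⟩ := hfgap
  -- `K` is both a bound for the number of exponents and the length of the final run of zeros. The
  -- summand 2D + 2J covers the exponent 2 + 2(D + J + 1) of K needed in `hYG`; 20 leaves room for
  -- the numerical constants.
  obtain ⟨K, N, G, hfK, hgK, hEK, hKG, hGN, hβK, hdense⟩ :=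
    hscale J (E₀ + y₀ + 2 * D + 2 * J + 20)
  set E := E₀ + y₀ + 2 * D + 2 * J + 20 with hE
  have hK20 : 20 ≤ K := by omega
  have hA1 : 1 ≤ partialSum f N := by
    refine (Nat.pos_of_ne_zero hf0).trans_le ?_
    exact single_le_sum (f := fun n ↦ PowerSeries.coeff n f) (fun _ _ ↦ Nat.zero_le _)
      (mem_range.2 (Nat.succ_pos N))
  -- the supports of the series, cut at `N`
  let supp : PowerSeries ℕ → Finset ℕ := fun f ↦
    (range (N + 1)).filter (fun n ↦ PowerSeries.coeff n f ≠ 0)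
  have hcard : ∀ i j, (supp (f ^ i * g ^ j)).card ≤ partialSum f N ^ i * K ^ j := fun i j ↦
    (card_support_le_partialSum _ _).trans <| (partialSum_pow_mul_pow_le _ _ _ _ _).trans <|
      Nat.mul_le_mul_left _ (Nat.pow_le_pow_left hgK _)
  let T := supp (f ^ I * g ^ (J + 1))
  let U := supp (f ^ D * g ^ J)
  let S := supp h
  have hS : S.card ≤ K ^ (D + (J + 1)) :=
    (hcard _ _).trans (by rw [pow_add _ D]; exact Nat.mul_le_mul_right _ (Nat.pow_le_pow_left hfK _))
  have hT : T.card ≤ K ^ (D + (J + 1)) :=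
    (card_le_card fun n hn ↦ by
      simp only [T, S, supp, mem_filter] at hn ⊢
      refine ⟨hn.1, ?_⟩
      have : _ ≤ PowerSeries.coeff n h :=
        coeff_pow_mul_pow_mono hf0 hg0 (by omega : I ≤ D) le_rfl n
      omega).trans hS
  have hU : U.card ≤ partialSum f N ^ E * K ^ J :=
    (hcard _ _).trans (Nat.mul_le_mul_right _ (Nat.pow_le_pow_right hA1 (by omega)))
  have hcS : ∀ n ≤ N, c n ≠ 0 → n ∈ S := fun n hn hcn ↦ by
    refine mem_filter.2 ⟨mem_range.2 (by omega), fun h0 ↦ hcn ?_⟩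
    refine sum_eq_zero fun e' he' ↦ ?_
    have := hρh e' he' n
    rw [h0, Nat.le_zero] at this
    rw [this]
    simp
  -- A nonleading monomial either has Y-degree at most J, and its exponents lie in `U`, or has
  -- Y-degree J + 1 and X-degree at most I, and they lie in `T`.
  have hlead : ∀ n ≤ N, n ∉ T → n ∉ U → c n = P.coeff e * ρ e n := fun n hn hnT hnU ↦ by
    refine sum_eq_single e (fun e' he' hne ↦ ?_) (fun h ↦ absurd heP h)
    have h0 : ρ e' n = 0 := by
      rcases he e' he' hne with h | h
      · have h1 : ρ e' n ≤ PowerSeries.coeff n (f ^ D * g ^ J) :=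
          coeff_pow_mul_pow_mono hf0 hg0 (hDle e' he') (by omega) n
        simp only [U, supp, mem_filter, mem_range, not_and, not_not] at hnU
        have := hnU (by omega)
        omega
      · have h1 : ρ e' n ≤ PowerSeries.coeff n (f ^ I * g ^ (J + 1)) :=
          coeff_pow_mul_pow_mono hf0 hg0 (by omega) (by omega) n
        simp only [T, supp, mem_filter, mem_range, not_and, not_not] at hnT
        have := hnT (by omega)
        omega
    simp [h0]
  set Q := K ^ (D + (J + 1)) with hQ
  have hQ1 : 1 ≤ Q := Nat.one_le_pow _ _ (by omega)
  -- a long block without points of `U`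
  obtain ⟨j₁, hj₁, hblock⟩ := exists_window_free U 0 (2 * G) (U.card + 1) (Nat.lt_succ_self _)
  rw [zero_add] at hblock
  set x := j₁ * (2 * G) with hx
  have hxN : x + 2 * G ≤ N := by
    have h1 : x + 2 * G ≤ (U.card + 1) * (2 * G) := by
      rw [hx, ← Nat.succ_mul]
      exact Nat.mul_le_mul_right _ hj₁
    have h2 : 1 ≤ partialSum f N ^ E * K ^ J :=
      Nat.mul_pos (Nat.pow_pos hA1) (Nat.pow_pos (by omega))
    have h3 : (U.card + 1) * (2 * G) ≤ (2 * (partialSum f N ^ E * K ^ J)) * (2 * G) :=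
      Nat.mul_le_mul_right _ (by omega)
    have h4 : (2 * (partialSum f N ^ E * K ^ J)) * (2 * G) ≤
        E * (G * (partialSum f N ^ E * K ^ J)) := by
      have : (2 * (partialSum f N ^ E * K ^ J)) * (2 * G) =
        4 * (G * (partialSum f N ^ E * K ^ J)) := by ring
      rw [this]
      exact Nat.mul_le_mul_right _ (by omega)
    have h5 : E * (G * (partialSum f N ^ E * K ^ J)) = E * G * partialSum f N ^ E * K ^ J := by
      ring
    omega
  -- Aiming at the midpoint of the block places t₀ in [x, x + G], leaving length G free of `U` after
  -- it.
  obtain ⟨t₀, ht₀, ht₀x, hxt₀⟩ := hdense (x + G) (by omega)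
  -- Y holds Q + 1 windows of length K, one more than the points of `S`.
  set Y := K * (Q + 1) with hY
  have hYG : 4 * Y * (Q + 1) ≤ G := by
    refine le_trans ?_ hKG
    have h1 : Q + 1 ≤ 2 * Q := by omega
    calc 4 * Y * (Q + 1) = 4 * K * ((Q + 1) * (Q + 1)) := by rw [hY]; ring
      _ ≤ 4 * K * (2 * Q * (2 * Q)) := by gcongr
      _ = 16 * K * (Q * Q) := by ring
      _ ≤ K * K * (Q * Q) := by gcongr; omega
      _ = K ^ (2 + (D + (J + 1)) + (D + (J + 1))) := by rw [hQ]; ring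
      _ ≤ K ^ E := Nat.pow_le_pow_right (by omega) (by omega)
  -- a long window without points of `T`
  obtain ⟨j₂, hj₂, hwin⟩ := exists_window_free T t₀ (4 * Y) (Q + 1) (by omega)
  set R₂ := t₀ + j₂ * (4 * Y) with hR₂
  have hR₂x : R₂ + 4 * Y ≤ x + 2 * G := by
    have h1 : (j₂ + 1) * (4 * Y) ≤ (Q + 1) * (4 * Y) := Nat.mul_le_mul_right _ hj₂
    have h2 : (Q + 1) * (4 * Y) = 4 * Y * (Q + 1) := by ring
    rw [Nat.succ_mul] at h1
    omega
  have ht₀T : t₀ ∈ T := by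
    refine mem_filter.2 ⟨mem_range.2 (by omega), ?_⟩
    have := coeff_add_mul_ne_zero (coeff_zero_pow_ne_zero hf0 I) ht₀
    rwa [zero_add] at this
  -- Retreating to the last point of `T` up to R₂ makes the free stretch start right after an
  -- exponent of f^I g^(J+1).
  obtain ⟨t, ht, htmax⟩ := exists_max_image (T.filter (fun n ↦ n ≤ R₂)) id
    ⟨t₀, mem_filter.2 ⟨ht₀T, by omega⟩⟩
  rw [mem_filter] at ht
  have ht₀t : t₀ ≤ t := htmax t₀ (mem_filter.2 ⟨ht₀T, by omega⟩)
  have hfree : ∀ n, t < n → n < t + 4 * Y + 1 → n ∉ T ∧ n ∉ U := fun n hn hn' ↦ by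
    constructor
    · intro hnT
      by_cases hnR : n ≤ R₂
      · have := htmax n (mem_filter.2 ⟨hnT, hnR⟩)
        simp only [id] at this
        omega
      · have := hwin n hnT (by omega)
        omega
    · intro hnU
      have := hblock n hnU (by omega)
      omega
  have hKY : K ≤ Y := Nat.le_mul_of_pos_right _ (Nat.succ_pos _)
  obtain ⟨a, haf, hYa, haY⟩ := hy₀ Y (by omega)
  set p := t + a with hp
  have hep : P.coeff e ≠ 0 := MvPolynomial.mem_support_iff.1 heP
  have hρp : ρ e p ≠ 0 := by
    have h1 : PowerSeries.coeff t (f ^ I * g ^ (J + 1)) ≠ 0 := (mem_filter.1 ht.1).2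
    have h2 := coeff_add_mul_ne_zero h1 haf
    have h3 : f ^ I * g ^ (J + 1) * f = f ^ e 0 * g ^ e 1 := by
      rw [hI, hJ]
      ring
    rwa [h3] at h2
  -- a window without nonzero coefficients before `p`
  obtain ⟨j₃, hj₃, hwin₃⟩ := exists_window_free S t K (Q + 1) (by omega)
  have hj₃K : j₃ * K + K ≤ Y := by
    rw [← Nat.succ_mul, hY, mul_comm K]
    exact Nat.mul_le_mul_right _ hj₃
  obtain ⟨n, hn1, hn2, hn3⟩ := hE₀ t p (t + 4 * Y + 1) N K (P.coeff e) (by omega) (by omega)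
    (fun n hn hn' ↦ by
      rw [hlead n (by omega) (hfree n hn hn').1 (hfree n hn hn').2, ← mul_assoc]
      exact mul_nonneg (mul_self_nonneg _) (Int.natCast_nonneg _))
    (by
      have h1 := hfree p (by omega) (by omega)
      rw [hlead p (by omega) h1.1 h1.2]
      exact mul_ne_zero hep (mul_ne_zero hep (by exact_mod_cast hρp)))
    (by
      refine le_trans ?_ hβK
      have h1 : (1 : ℝ) ≤ (N : ℝ) + 2 := by linarith [(Nat.cast_nonneg N : (0 : ℝ) ≤ N)]
      have h2 : E₀ ≤ E := by omega
      have h3 : (E₀ : ℝ) ≤ E := by exact_mod_cast h2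
      gcongr)
    (by omega) (t + j₃ * K) (by omega) (by omega) (by omega)
  have := hwin₃ n (hcS n (by omega) hn3) hn1
  omega

/-! ### Growth and gaps of the two exponent sequences -/

open Filter

/-- The integer part of `m ^ (log m)`. -/
noncomputable def logFloor (m : ℕ) : ℕ := ⌊(m : ℝ) ^ Real.log m⌋₊

/-- The integer part of `m ^ (log log m)`. -/
noncomputable def logLogFloor (m : ℕ) : ℕ := ⌊(m : ℝ) ^ Real.log (Real.log m)⌋₊

theorem one_le_log_of_three_le {x : ℝ} (hx : 3 ≤ x) : 1 ≤ Real.log x := by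
  rw [Real.le_log_iff_exp_le (by linarith)]
  linarith [Real.exp_one_lt_d9]

theorem one_le_log_log {x : ℝ} (hx : 27 ≤ x) : 1 ≤ Real.log (Real.log x) := by
  refine one_le_log_of_three_le ?_
  rw [Real.le_log_iff_exp_le (by linarith)]
  have h : Real.exp 3 = Real.exp 1 ^ 3 := by rw [← Real.exp_nat_mul]; norm_num
  rw [h]
  calc Real.exp 1 ^ 3 ≤ 3 ^ 3 := by
        have := Real.exp_one_lt_d9
        gcongr
        linarith
    _ ≤ x := by linarith

theorem le_logFloor {m : ℕ} (hm : 3 ≤ m) : m ≤ logFloor m := by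
  have hm' : (3 : ℝ) ≤ m := by exact_mod_cast hm
  refine Nat.le_floor ?_
  exact Real.self_le_rpow_of_one_le (by linarith) (one_le_log_of_three_le hm')

theorem le_logLogFloor {m : ℕ} (hm : 27 ≤ m) : m ≤ logLogFloor m := by
  have hm' : (27 : ℝ) ≤ m := by exact_mod_cast hm
  refine Nat.le_floor ?_
  exact Real.self_le_rpow_of_one_le (by linarith) (one_le_log_log hm')

theorem rpow_log_log_le {x y : ℝ} (hx : 3 ≤ x) (hxy : x ≤ y) :
    x ^ Real.log (Real.log x) ≤ y ^ Real.log (Real.log y) := by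
  have h1 := one_le_log_of_three_le hx
  have h2 : Real.log x ≤ Real.log y := Real.log_le_log (by linarith) hxy
  have h3 : Real.log (Real.log x) ≤ Real.log (Real.log y) := Real.log_le_log (by linarith) h2
  calc x ^ Real.log (Real.log x) ≤ y ^ Real.log (Real.log x) :=
        Real.rpow_le_rpow (by linarith) hxy (Real.log_nonneg h1)
    _ ≤ _ := Real.rpow_le_rpow_of_exponent_le (by linarith) h3

theorem logLogFloor_mono {k m : ℕ} (hk : 3 ≤ k) (hkm : k ≤ m) :
    logLogFloor k ≤ logLogFloor m :=
  Nat.floor_le_floor (rpow_log_log_le (by exact_mod_cast hk) (by exact_mod_cast hkm))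

theorem log_add_one_le {x : ℝ} (hx : 0 < x) : Real.log (x + 1) ≤ Real.log x + 1 / x := by
  have h : x + 1 = x * (1 + 1 / x) := by field_simp
  rw [h, Real.log_mul hx.ne' (by positivity)]
  have := Real.log_le_sub_one_of_pos (show 0 < 1 + 1 / x by positivity)
  linarith

/-- The increment of (log m)² is about 2 (log m)/m, so the ratio of consecutive values tends to 1.
The bound 3/2 before rounding leaves room for the floor. -/
theorem eventually_logFloor_succ_le :
    ∀ᶠ m : ℕ in atTop, logFloor (m + 1) ≤ 2 * logFloor m := by
  have h1 : ∀ᶠ x : ℝ in atTop, ‖Real.log x‖ ≤ 1 / 16 * ‖id x‖ :=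
    Real.isLittleO_log_id_atTop.def (by norm_num)
  filter_upwards [tendsto_natCast_atTop_atTop.eventually h1, eventually_ge_atTop 16] with m h1 hm
  have hm' : (16 : ℝ) ≤ m := by exact_mod_cast hm
  have hl := one_le_log_of_three_le (show (3 : ℝ) ≤ m by linarith)
  rw [Real.norm_of_nonneg (by linarith), id, Real.norm_of_nonneg (by linarith)] at h1
  have h2 : Real.log (m + 1) ^ 2 ≤ Real.log m ^ 2 + 1 / 4 := by
    have h3 := log_add_one_le (show (0 : ℝ) < m by linarith)
    have h4 : (0 : ℝ) ≤ Real.log (m + 1) := Real.log_nonneg (by linarith)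
    have h5 : Real.log (m + 1) ^ 2 ≤ (Real.log m + 1 / m) ^ 2 := by gcongr
    have h6 : (1 : ℝ) / m ≤ 1 / 16 := by gcongr
    have h7 : Real.log m * (1 / m) ≤ 1 / 16 := by
      rw [mul_one_div, div_le_iff₀ (by linarith)]
      exact h1
    have h8 : (0 : ℝ) ≤ 1 / m := by positivity
    nlinarith
  have h3 : ((m + 1 : ℕ) : ℝ) ^ Real.log (m + 1 : ℕ) ≤ 3 / 2 * (m : ℝ) ^ Real.log m := by
    push_cast
    rw [Real.rpow_def_of_pos (by linarith), Real.rpow_def_of_pos (by linarith), ← sq, ← sq]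
    have h4 : Real.exp (1 / 4) ≤ 3 / 2 := by
      have h5 : Real.exp (1 / 4) ^ 4 = Real.exp 1 := by rw [← Real.exp_nat_mul]; norm_num
      have h6 := Real.exp_one_lt_d9
      by_contra! h7
      have : (3 / 2 : ℝ) ^ 4 < Real.exp (1 / 4) ^ 4 := by gcongr
      linarith
    calc Real.exp (Real.log (m + 1) ^ 2) ≤ Real.exp (1 / 4 + Real.log m ^ 2) := by
          gcongr
          linarith
      _ ≤ _ := by rw [Real.exp_add]; gcongr
  have h4 := Nat.lt_floor_add_one ((m : ℝ) ^ Real.log m)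
  have h5 := le_logFloor (show 3 ≤ m by omega)
  have h6 : (16 : ℝ) ≤ (logFloor m : ℝ) := by exact_mod_cast hm.trans h5
  have h7 := Nat.floor_le (show 0 ≤ ((m + 1 : ℕ) : ℝ) ^ Real.log (m + 1 : ℕ) by positivity)
  change (logFloor (m + 1) : ℝ) ≤ _ at h7
  change _ < (logFloor m : ℝ) + 1 at h4
  have : (logFloor (m + 1) : ℝ) ≤ 2 * logFloor m := by linarith
  exact_mod_cast this

/-- The values of `logFloor` meet every interval `[y, 2 y]` with `y` large. -/
theorem exists_logFloor_mem :
    ∃ y₀ : ℕ, ∀ y ≥ y₀, ∃ m, y ≤ logFloor (m + 1) ∧ logFloor (m + 1) ≤ 2 * y := by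
  obtain ⟨k, hk⟩ := eventually_atTop.1 eventually_logFloor_succ_le
  refine ⟨logFloor (k + 1) + 1, fun y hy ↦ ?_⟩
  have hex : ∃ m, y ≤ logFloor (k + 1 + m) :=
    ⟨y + 3, (by omega : y ≤ k + 1 + (y + 3)).trans (le_logFloor (by omega))⟩
  classical
  obtain ⟨n, hn⟩ : ∃ n, Nat.find hex = n + 1 := by
    refine Nat.exists_eq_succ_of_ne_zero fun h0 ↦ ?_
    have := Nat.find_spec hex
    rw [h0, add_zero] at this
    omega
  have h1 := Nat.find_spec hex
  have h2 := Nat.find_min hex (show n < Nat.find hex by omega)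
  rw [hn] at h1
  have h3 := hk (k + 1 + n) (by omega)
  refine ⟨k + 1 + n, h1, ?_⟩
  omega

/-- The increment of log k · log log k is about (log log k + 1)/k, which is eventually below any
fixed multiple of k^(ε-1). -/
theorem eventually_logLogFloor_succ_le {ε : ℝ} (hε : 0 < ε) (hε1 : ε < 1) :
    ∀ᶠ k : ℕ in atTop,
      (logLogFloor (k + 1) : ℝ) ≤ logLogFloor k + logLogFloor k * (k : ℝ) ^ (ε - 1) := by
  have h1 : ∀ᶠ x : ℝ in atTop, ‖Real.log x‖ ≤ 1 / 16 * ‖x ^ ε‖ :=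
    (isLittleO_log_rpow_atTop hε).def (by norm_num)
  have h2 : ∀ᶠ x : ℝ in atTop, 32 ≤ x ^ ε := (tendsto_rpow_atTop hε).eventually_ge_atTop 32
  filter_upwards [tendsto_natCast_atTop_atTop.eventually h1,
    tendsto_natCast_atTop_atTop.eventually h2, eventually_ge_atTop 27] with k h1 h2 hk
  have hk' : (27 : ℝ) ≤ k := by exact_mod_cast hk
  have hk0 : (0 : ℝ) < k := by linarith
  have hl := one_le_log_of_three_le (show (3 : ℝ) ≤ k by linarith)
  have hll := one_le_log_log hk'
  rw [Real.norm_of_nonneg (by linarith), Real.norm_of_nonneg (by positivity)] at h1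
  have hkε : (k : ℝ) ^ (ε - 1) * k = (k : ℝ) ^ ε := by
    rw [← Real.rpow_add_one hk0.ne', sub_add_cancel]
  have hkε0 : 0 < (k : ℝ) ^ (ε - 1) := by positivity
  have hkε1 : (k : ℝ) ^ (ε - 1) ≤ 1 := Real.rpow_le_one_of_one_le_of_nonpos (by linarith)
    (by linarith)
  have hφ : Real.log (k + 1) * Real.log (Real.log (k + 1)) ≤
      Real.log k * Real.log (Real.log k) + (k : ℝ) ^ (ε - 1) / 8 := by
    have h3 := log_add_one_le hk0
    have h3' : Real.log k ≤ Real.log (k + 1) := Real.log_le_log hk0 (by linarith)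
    have h4 : Real.log (Real.log (k + 1)) ≤ Real.log (Real.log k) + 1 / k / Real.log k := by
      have h5 : Real.log (Real.log (k + 1)) ≤ Real.log (Real.log k * (1 + 1 / k / Real.log k)) := by
        refine Real.log_le_log (by linarith) (h3.trans (le_of_eq ?_))
        field_simp
      rw [Real.log_mul (by linarith) (by positivity)] at h5
      have := Real.log_le_sub_one_of_pos (show 0 < 1 + 1 / (k : ℝ) / Real.log k by positivity)
      linarith
    have h5 : Real.log (Real.log k) ≤ Real.log k := Real.log_le_self (by linarith)
    calc Real.log (k + 1) * Real.log (Real.log (k + 1))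
        ≤ (Real.log k + 1 / k) * (Real.log (Real.log k) + 1 / k / Real.log k) := by
          gcongr
          refine Real.log_nonneg (by linarith)
      _ = Real.log k * Real.log (Real.log k) +
          (Real.log (Real.log k) + 1 + 1 / k / Real.log k) / k := by
          field_simp
          ring
      _ ≤ Real.log k * Real.log (Real.log k) + (k : ℝ) ^ ε / 8 / k := by
          have h6 : 1 / (k : ℝ) / Real.log k ≤ 1 := by
            rw [div_le_one (by linarith), div_le_iff₀ hk0]
            nlinarith
          gcongr
          linarith
      _ = _ := by
          rw [← hkε]
          field_simp
  have hF : ((k + 1 : ℕ) : ℝ) ^ Real.log (Real.log (k + 1 : ℕ)) ≤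
      (k : ℝ) ^ Real.log (Real.log k) * (1 + (k : ℝ) ^ (ε - 1) / 4) := by
    push_cast
    rw [Real.rpow_def_of_pos (by linarith), Real.rpow_def_of_pos hk0]
    refine (Real.exp_le_exp.2 hφ).trans ?_
    rw [Real.exp_add]
    gcongr
    set δ := (k : ℝ) ^ (ε - 1) / 8 with hδ
    have hδ1 : |δ| ≤ 1 := by rw [abs_of_nonneg (by positivity)]; linarith
    have := Real.abs_exp_sub_one_le hδ1
    rw [abs_of_nonneg (by positivity : 0 ≤ δ)] at this
    have := le_of_abs_le this
    linarith
  have h7 := Nat.floor_le (show 0 ≤ ((k + 1 : ℕ) : ℝ) ^ Real.log (Real.log (k + 1 : ℕ)) by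
    positivity)
  change (logLogFloor (k + 1) : ℝ) ≤ _ at h7
  have h8 := Nat.lt_floor_add_one ((k : ℝ) ^ Real.log (Real.log k))
  change _ < (logLogFloor k : ℝ) + 1 at h8
  have h9 : (k : ℝ) ≤ logLogFloor k := by exact_mod_cast le_logLogFloor hk
  have h10 : (k : ℝ) ^ (ε - 1) * k ≤ (k : ℝ) ^ (ε - 1) * logLogFloor k := by gcongr
  have h11 : (k : ℝ) ^ Real.log (Real.log k) * (1 + (k : ℝ) ^ (ε - 1) / 4) ≤
      (logLogFloor k + 1) * (1 + (k : ℝ) ^ (ε - 1) / 4) := by gcongr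
  rw [hkε] at h10
  nlinarith

/-! ### Density, counting and the choice of scale -/

/-- Greedy approximation by sums of elements of the support. -/
theorem exists_coeff_pow_ne_zero_near {g : PowerSeries ℕ} {N : ℕ} {B q : ℝ} (hB : 0 ≤ B)
    (hq : 0 ≤ q) (hq1 : q ≤ 1)
    (h : ∀ y ≤ N, ∃ s, PowerSeries.coeff s g ≠ 0 ∧ s ≤ y ∧ (y : ℝ) - s ≤ max B (q * y)) (j : ℕ) :
    ∀ y ≤ N, ∃ t, PowerSeries.coeff t (g ^ j) ≠ 0 ∧ t ≤ y ∧ (y : ℝ) - t ≤ max B (q ^ j * y) := by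
  induction j with
  | zero => exact fun y _ ↦ ⟨0, by simp, Nat.zero_le _, by simp⟩
  | succ j ih =>
    intro y hy
    obtain ⟨t, ht, hty, htB⟩ := ih y hy
    obtain ⟨s, hs, hsy, hsB⟩ := h (y - t) (by omega)
    refine ⟨t + s, ?_, by omega, ?_⟩
    · rw [pow_succ]
      exact coeff_add_mul_ne_zero ht hs
    · rw [Nat.cast_sub hty] at hsB
      push_cast
      have h1 : q * ((y : ℝ) - t) ≤ max B (q ^ (j + 1) * y) := by
        refine (mul_le_mul_of_nonneg_left htB hq).trans ?_
        rw [mul_max_of_nonneg _ _ hq]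
        refine max_le_max (mul_le_of_le_one_left hB hq1) (le_of_eq ?_)
        ring
      have h2 : max B (q * ((y : ℝ) - t)) ≤ max B (q ^ (j + 1) * y) := max_le (le_max_left _ _) h1
      linarith

theorem tendsto_log_log_natCast :
    Tendsto (fun K : ℕ ↦ Real.log (Real.log K)) atTop atTop :=
  Real.tendsto_log_atTop.comp (Real.tendsto_log_atTop.comp tendsto_natCast_atTop_atTop)

/-- One greedy step: take the last value not exceeding y. If y > F^(1-η), with F = K^(log log K),
its index is at least about K^(1-η), so the relative gap is nearly 1/K. Smaller y are approximated
by 0. -/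
theorem eventually_exists_logLogFloor_near {η : ℝ} (hη : 0 < η) (hη1 : η < 1) :
    ∀ᶠ K : ℕ in atTop, ∀ y < logLogFloor K, ∃ s, (s = 0 ∨ ∃ m, s = logLogFloor (m + 3)) ∧ s ≤ y ∧
      (y : ℝ) - s ≤ max (((K : ℝ) ^ Real.log (Real.log K)) ^ (1 - η))
        (2 * (K : ℝ) ^ (-(1 - 2 * η)) * y) := by
  obtain ⟨k₀, hk₀⟩ := eventually_atTop.1 (eventually_logLogFloor_succ_le hη hη1)
  have hη' : 0 < 1 - η := by linarith
  have h1 : ∀ᶠ K : ℕ in atTop, (logLogFloor (k₀ + 27) : ℝ) ≤ (K : ℝ) ^ (1 - η) :=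
    ((tendsto_rpow_atTop hη').comp tendsto_natCast_atTop_atTop).eventually_ge_atTop _
  filter_upwards [h1, eventually_ge_atTop (k₀ + 27)] with K h1 hK y hy
  have hK' : (27 : ℝ) ≤ K := by exact_mod_cast (by omega : 27 ≤ K)
  have hll := one_le_log_log hK'
  set F := (K : ℝ) ^ Real.log (Real.log K) with hF
  have hKF : (K : ℝ) ≤ F := Real.self_le_rpow_of_one_le (by linarith) hll
  rcases le_or_gt (y : ℝ) (F ^ (1 - η)) with hyF | hyF
  · exact ⟨0, Or.inl rfl, Nat.zero_le _, by simpa using Or.inl hyF⟩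
  have h2 : (K : ℝ) ^ (1 - η) ≤ F ^ (1 - η) := by gcongr
  have hky : logLogFloor (k₀ + 27) ≤ y := by
    have : (logLogFloor (k₀ + 27) : ℝ) ≤ y := by linarith
    exact_mod_cast this
  classical
  have hex : ∃ i, y < logLogFloor (k₀ + 27 + i) :=
    ⟨K - (k₀ + 27), by rwa [Nat.add_sub_cancel' hK]⟩
  obtain ⟨n, hn⟩ : ∃ n, Nat.find hex = n + 1 := by
    refine Nat.exists_eq_succ_of_ne_zero fun h0 ↦ ?_
    have := Nat.find_spec hex
    rw [h0, add_zero] at this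
    omega
  have h3 := Nat.find_spec hex
  have h4 := Nat.find_min hex (show n < Nat.find hex by omega)
  have h5 := Nat.find_min' hex (m := K - (k₀ + 27)) (by rwa [Nat.add_sub_cancel' hK])
  rw [hn] at h3 h5
  set k := k₀ + 27 + n with hk
  rw [show k₀ + 27 + (n + 1) = k + 1 by omega] at h3
  have hkK : k + 1 ≤ K := by omega
  push Not at h4
  refine ⟨logLogFloor k, Or.inr ⟨k - 3, by rw [Nat.sub_add_cancel (by omega)]⟩, h4, ?_⟩
  refine le_trans ?_ (le_max_right _ _)
  have hk27 : (27 : ℝ) ≤ k := by exact_mod_cast (by omega : 27 ≤ k)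
  have h6 : (K : ℝ) ^ (1 - η) ≤ (k : ℝ) + 1 := by
    have h7 : (y : ℝ) < ((k + 1 : ℕ) : ℝ) ^ Real.log (Real.log (k + 1 : ℕ)) :=
      (Nat.le_floor_iff (by positivity)).1 (Nat.succ_le_of_lt h3) |>.trans_lt' (by simp)
    have hkK' : ((k + 1 : ℕ) : ℝ) ≤ K := by exact_mod_cast hkK
    have hl1 := one_le_log_of_three_le (show (3 : ℝ) ≤ ((k + 1 : ℕ) : ℝ) by push_cast; linarith)
    have h8 : ((k + 1 : ℕ) : ℝ) ^ Real.log (Real.log (k + 1 : ℕ)) ≤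
        ((k + 1 : ℕ) : ℝ) ^ Real.log (Real.log K) := by
      refine Real.rpow_le_rpow_of_exponent_le (by push_cast; linarith) ?_
      refine Real.log_le_log (by linarith) (Real.log_le_log (by positivity) hkK')
    have h9 : F ^ (1 - η) = ((K : ℝ) ^ (1 - η)) ^ Real.log (Real.log K) := by
      rw [hF, ← Real.rpow_mul (by positivity), ← Real.rpow_mul (by positivity), mul_comm]
    have h10 : ((K : ℝ) ^ (1 - η)) ^ Real.log (Real.log K) <
        ((k + 1 : ℕ) : ℝ) ^ Real.log (Real.log K) := by linarith
    have := (Real.rpow_lt_rpow_iff (by positivity) (by positivity) (by linarith)).1 h10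
    push_cast at this
    exact this.le
  have h11 := hk₀ k (by omega)
  have h12 : (y : ℝ) ≤ logLogFloor (k + 1) := by exact_mod_cast h3.le
  have h13 : (logLogFloor k : ℝ) ≤ y := by exact_mod_cast h4
  -- Here (1 - η)² ≥ 1 - 2η, and the factor 2 absorbs k ≥ K^(1-η)/2.
  have h14 : (k : ℝ) ^ (η - 1) ≤ 2 * (K : ℝ) ^ (-(1 - 2 * η)) := by
    have h15 : (K : ℝ) ^ (1 - η) / 2 ≤ k := by linarith
    have hK1 : (1 : ℝ) ≤ K := by linarith
    calc (k : ℝ) ^ (η - 1) ≤ ((K : ℝ) ^ (1 - η) / 2) ^ (η - 1) :=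
          Real.rpow_le_rpow_of_nonpos (by positivity) h15 (by linarith)
      _ = (K : ℝ) ^ ((1 - η) * (η - 1)) * 2 ^ (1 - η) := by
          rw [Real.div_rpow (by positivity) (by norm_num), ← Real.rpow_mul (by positivity),
            div_eq_mul_inv, ← Real.rpow_neg (by norm_num), neg_sub]
      _ ≤ (K : ℝ) ^ (-(1 - 2 * η)) * 2 ^ (1 : ℝ) := by
          gcongr
          · nlinarith
          · norm_num
          · linarith
      _ = _ := by rw [Real.rpow_one, mul_comm]
  calc (y : ℝ) - logLogFloor k ≤ logLogFloor k * (k : ℝ) ^ (η - 1) := by linarith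
    _ ≤ y * (2 * (K : ℝ) ^ (-(1 - 2 * η))) := by gcongr
    _ = _ := by ring

/-- If m ≥ K^δ then (log m)² ≥ δ² (log K)², which eventually exceeds log K · log log K. This is the
sense in which the first sequence is much sparser than the second. -/
theorem partialSum_logFloor_le {δ : ℝ} (hδ : 0 < δ) :
    ∀ᶠ K : ℕ in atTop, (partialSum (countSeries fun m ↦ logFloor (m + 1))
      (logLogFloor K - 1) : ℝ) ≤ 3 * (K : ℝ) ^ δ := by
  have h1 : ∀ᶠ x : ℝ in atTop, ‖Real.log x‖ ≤ δ ^ 2 * ‖id x‖ :=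
    Real.isLittleO_log_id_atTop.def (by positivity)
  have h2 := (Real.tendsto_log_atTop.comp tendsto_natCast_atTop_atTop).eventually h1
  filter_upwards [h2, eventually_ge_atTop 27] with K h2 hK
  have hK' : (27 : ℝ) ≤ K := by exact_mod_cast hK
  have hl := one_le_log_of_three_le (show (3 : ℝ) ≤ K by linarith)
  have hll := one_le_log_log hK'
  simp only [Function.comp, id] at h2
  rw [Real.norm_of_nonneg (by linarith), Real.norm_of_nonneg (by linarith)] at h2
  have h3 : 1 ≤ logLogFloor K := by have := le_logLogFloor hK; omega
  have h4 : partialSum (countSeries fun m ↦ logFloor (m + 1)) (logLogFloor K - 1) ≤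
      ⌈(K : ℝ) ^ δ⌉₊ + 1 := by
    refine partialSum_countSeries_le fun m hm ↦ ?_
    by_contra! h5
    have h6 : (K : ℝ) ^ δ ≤ (m + 1 : ℕ) := by
      refine (Nat.ceil_le.1 h5).trans ?_
      push_cast
      linarith
    have h7 : logLogFloor K ≤ logFloor (m + 1) := by
      refine Nat.floor_le_floor ?_
      have hpos : (0 : ℝ) < (m + 1 : ℕ) := by positivity
      rw [Real.rpow_def_of_pos (by linarith), Real.rpow_def_of_pos hpos]
      refine Real.exp_le_exp.2 ?_
      have h8 : δ * Real.log K ≤ Real.log (m + 1 : ℕ) := by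
        rw [← Real.log_rpow (by linarith)]
        exact Real.log_le_log (by positivity) h6
      have h9 : 0 ≤ δ * Real.log K := by positivity
      nlinarith
    omega
  have h5 := Nat.ceil_lt_add_one (show 0 ≤ (K : ℝ) ^ δ by positivity)
  have h6 : 1 ≤ (K : ℝ) ^ δ := Real.one_le_rpow (by linarith) hδ.le
  have h7 : (partialSum (countSeries fun m ↦ logFloor (m + 1)) (logLogFloor K - 1) : ℝ) ≤
      ⌈(K : ℝ) ^ δ⌉₊ + 1 := by exact_mod_cast h4
  linarith

theorem partialSum_logLogFloor_le {K : ℕ} (hK : 27 ≤ K) :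
    partialSum (countSeries fun m ↦ logLogFloor (m + 3)) (logLogFloor K - 1) ≤ K := by
  have h3 := le_logLogFloor hK
  have := partialSum_countSeries_le (s := fun m ↦ logLogFloor (m + 3)) (N := logLogFloor K - 1)
    (M := K - 3) fun m hm ↦ by
      by_contra! h5
      have := logLogFloor_mono (k := K) (m := m + 3) (by omega) (by omega)
      omega
  omega

/-- The logarithm of `logLogFloor K` is O((log K)²), which is o(K). -/
theorem eventually_mul_pow_le_pow {β : ℝ} (hβ : 1 < β) (E : ℕ) :
    ∀ᶠ K : ℕ in atTop, E * (((logLogFloor K - 1 : ℕ) : ℝ) + 2) ^ E ≤ β ^ K := by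
  have hb : 0 < Real.log β := Real.log_pos hβ
  have h1 : ∀ᶠ x : ℝ in atTop, ‖Real.log x ^ 2‖ ≤ Real.log β / (4 * (E + 1)) * ‖id x‖ :=
    (Real.isLittleO_pow_log_id_atTop (n := 2)).def (by positivity)
  have h2 : ∀ᶠ x : ℝ in atTop, ‖Real.log x‖ ≤ 1 / 2 * ‖id x‖ :=
    Real.isLittleO_log_id_atTop.def (by norm_num)
  filter_upwards [tendsto_natCast_atTop_atTop.eventually h1,
    (Real.tendsto_log_atTop.comp tendsto_natCast_atTop_atTop).eventually h2,
    eventually_ge_atTop 27] with K h1 h2 hK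
  have hK' : (27 : ℝ) ≤ K := by exact_mod_cast hK
  have hl := one_le_log_of_three_le (show (3 : ℝ) ≤ K by linarith)
  have hll := one_le_log_log hK'
  simp only [Function.comp, id] at h1 h2
  rw [Real.norm_of_nonneg (by linarith), Real.norm_of_nonneg (by linarith)] at h2
  rw [Real.norm_of_nonneg (by positivity), Real.norm_of_nonneg (by linarith)] at h1
  have h3 : (((logLogFloor K - 1 : ℕ) : ℝ) + 2) ≤ Real.exp (2 * Real.log K ^ 2) := by
    have h4 := le_logLogFloor hK
    rw [Nat.cast_sub (by omega)]
    have h5 : (logLogFloor K : ℝ) ≤ (K : ℝ) ^ Real.log (Real.log K) :=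
      Nat.floor_le (by positivity)
    rw [Real.rpow_def_of_pos (by linarith)] at h5
    have h6 : Real.exp (Real.log K * Real.log (Real.log K)) ≤ Real.exp (Real.log K ^ 2) := by
      gcongr
      nlinarith
    have h7 : Real.exp (2 * Real.log K ^ 2) =
        Real.exp (Real.log K ^ 2) * Real.exp (Real.log K ^ 2) := by
      rw [← Real.exp_add]; ring_nf
    have h8 : Real.log K ^ 2 + 1 ≤ Real.exp (Real.log K ^ 2) := Real.add_one_le_exp _
    push_cast
    nlinarith
  have h4 : (E : ℝ) ≤ Real.exp E := by linarith [Real.add_one_le_exp (E : ℝ)]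
  calc E * (((logLogFloor K - 1 : ℕ) : ℝ) + 2) ^ E
      ≤ Real.exp E * Real.exp (2 * Real.log K ^ 2) ^ E := by gcongr
    _ = Real.exp (E + E * (2 * Real.log K ^ 2)) := by rw [Real.exp_add, Real.exp_nat_mul]
    _ ≤ Real.exp (K * Real.log β) := by
        gcongr
        rw [div_mul_eq_mul_div, le_div_iff₀ (by positivity)] at h1
        have h5 : 1 ≤ Real.log K ^ 2 := by nlinarith
        nlinarith [(Nat.cast_nonneg E : (0 : ℝ) ≤ E)]
    _ = β ^ K := by rw [Real.exp_nat_mul, Real.exp_log (by linarith)]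

/-- For large K, take N just below `logLogFloor K`, so that only indices below K count for the
second sequence, and G = ⌈q^(J+1) F⌉, the error of J + 1 greedy steps. -/
theorem exists_scale {β : ℝ} (hβ : 1 < β) (J E : ℕ) : ∃ K N G : ℕ,
    partialSum (countSeries fun m ↦ logFloor (m + 1)) N ≤ K ∧
      partialSum (countSeries fun m ↦ logLogFloor (m + 3)) N ≤ K ∧ E ≤ K ∧ K ^ E ≤ G ∧
      E * G * partialSum (countSeries fun m ↦ logFloor (m + 1)) N ^ E * K ^ J ≤ N ∧
      E * ((N : ℝ) + 2) ^ E ≤ β ^ K ∧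
      ∀ x ≤ N, ∃ t, PowerSeries.coeff t ((countSeries fun m ↦ logLogFloor (m + 3)) ^ (J + 1)) ≠ 0 ∧
        t ≤ x ∧ x ≤ t + G := by
  have hJ0 : (0 : ℝ) < (J + 1 : ℕ) := by positivity
  -- The J + 1 greedy steps lose K^(2η(J+1)) = K^(1/4) in total.
  set η : ℝ := 1 / (8 * (J + 1 : ℕ)) with hη
  have hη0 : 0 < η := by positivity
  have hη8 : η ≤ 1 / 8 := by
    rw [hη]
    gcongr
    push_cast
    linarith [(Nat.cast_nonneg J : (0 : ℝ) ≤ J)]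
  have hηJ : η * (J + 1 : ℕ) = 1 / 8 := by rw [hη]; field_simp
  -- Then A^E costs at most 3^E K^(1/16), so G A^E K^J / F is O(K^(-11/16)), below the K^(-1/2)
  -- used.
  set δ : ℝ := 1 / (16 * (E + 1)) with hδ
  have hδ0 : 0 < δ := by positivity
  have hδE : δ * E ≤ 1 / 16 := by
    rw [hδ, div_mul_eq_mul_div, div_le_iff₀ (by positivity)]
    linarith
  have hδ1 : δ ≤ 1 / 2 := by
    rw [hδ, div_le_iff₀ (by positivity)]
    linarith [(Nat.cast_nonneg E : (0 : ℝ) ≤ E)]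
  have hsqrt : Tendsto (fun K : ℕ ↦ (K : ℝ) ^ (1 / 2 : ℝ)) atTop atTop :=
    (tendsto_rpow_atTop (by norm_num)).comp tendsto_natCast_atTop_atTop
  obtain ⟨K, hnear, hA, hβK, hll, hsq, hK⟩ :=
    ((eventually_exists_logLogFloor_near hη0 (by linarith)).and <|
      (partialSum_logFloor_le hδ0).and <| (eventually_mul_pow_le_pow hβ E).and <|
      (tendsto_log_log_natCast.eventually_ge_atTop (8 * (J + 1 : ℕ) ^ 2 + E + (J + 1 : ℕ))).and <|
      (hsqrt.eventually_ge_atTop (3 + 4 * (E * 2 ^ (J + 2) * 3 ^ E))).and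
      (eventually_ge_atTop (27 + E))).exists
  have hK27 : (27 : ℝ) ≤ K := by exact_mod_cast (by omega : 27 ≤ K)
  have hK1 : (1 : ℝ) ≤ K := by linarith
  have hK0 : (0 : ℝ) < K := by linarith
  set F := (K : ℝ) ^ Real.log (Real.log K) with hF
  have hF0 : 0 < F := by positivity
  have hKF : (K : ℝ) ≤ F := Real.self_le_rpow_of_one_le hK1 (one_le_log_log hK27)
  have hKN := le_logLogFloor (show 27 ≤ K by omega)
  set N := logLogFloor K - 1 with hN
  set A := partialSum (countSeries fun m ↦ logFloor (m + 1)) N with hAdef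
  set q : ℝ := 2 * (K : ℝ) ^ (-(1 - 2 * η)) with hq
  have hq0 : 0 ≤ q := by positivity
  have hq1 : q ≤ 1 := by
    have h1 : (K : ℝ) ^ (-(1 - 2 * η)) ≤ (K : ℝ) ^ (-(1 / 2) : ℝ) :=
      Real.rpow_le_rpow_of_exponent_le hK1 (by linarith)
    rw [Real.rpow_neg hK0.le (1 / 2)] at h1
    have h2 : ((K : ℝ) ^ (1 / 2 : ℝ))⁻¹ ≤ 2⁻¹ := by
      gcongr
      have : (0 : ℝ) ≤ 4 * (E * 2 ^ (J + 2) * 3 ^ E) := by positivity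
      linarith
    linarith
  have hqJ : q ^ (J + 1) = 2 ^ (J + 1) * (K : ℝ) ^ (1 / 4 - (J + 1 : ℕ) : ℝ) := by
    rw [hq, mul_pow, ← Real.rpow_mul_natCast hK0.le]
    congr 2
    linear_combination 2 * hηJ
  have hηF : F ^ (1 - η) ≤ q ^ (J + 1) * F := by
    have h1 : F ^ (1 - η) = F * (K : ℝ) ^ (-(Real.log (Real.log K) * η)) := by
      rw [sub_eq_add_neg, Real.rpow_add hF0, Real.rpow_one, hF, ← Real.rpow_mul hK0.le, mul_neg]
    rw [h1, mul_comm, hqJ]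
    gcongr
    have h2 : (K : ℝ) ^ (-(Real.log (Real.log K) * η)) ≤ (K : ℝ) ^ (1 / 4 - (J + 1 : ℕ) : ℝ) := by
      refine Real.rpow_le_rpow_of_exponent_le hK1 ?_
      have h3 : ((J + 1 : ℕ) : ℝ) ≤ Real.log (Real.log K) * η := by
        have h4 : (8 * ((J + 1 : ℕ) : ℝ) ^ 2) * η ≤ Real.log (Real.log K) * η := by
          gcongr
          have : (0 : ℝ) ≤ E + (J + 1 : ℕ) := by positivity
          linarith
        have h5 : (8 * ((J + 1 : ℕ) : ℝ) ^ 2) * η = (J + 1 : ℕ) := by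
          linear_combination 8 * ((J + 1 : ℕ) : ℝ) * hηJ
        linarith
      linarith
    have h3 : (1 : ℝ) ≤ 2 ^ (J + 1) := one_le_pow₀ (by norm_num)
    have h4 : 0 ≤ (K : ℝ) ^ (1 / 4 - (J + 1 : ℕ) : ℝ) := by positivity
    nlinarith
  have hEG : (K : ℝ) ^ E ≤ q ^ (J + 1) * F := by
    calc (K : ℝ) ^ E = (K : ℝ) ^ (E : ℝ) := (Real.rpow_natCast _ _).symm
      _ ≤ (K : ℝ) ^ (1 / 4 - (J + 1 : ℕ) + Real.log (Real.log K) : ℝ) := by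
          refine Real.rpow_le_rpow_of_exponent_le hK1 ?_
          have : (0 : ℝ) ≤ 8 * ((J + 1 : ℕ) : ℝ) ^ 2 := by positivity
          linarith
      _ = 1 * (K : ℝ) ^ (1 / 4 - (J + 1 : ℕ) : ℝ) * F := by rw [Real.rpow_add hK0, one_mul]
      _ ≤ _ := by
          rw [hqJ]
          gcongr
          exact one_le_pow₀ (by norm_num)
  set G := ⌈q ^ (J + 1) * F⌉₊ with hG
  have hGle : q ^ (J + 1) * F ≤ G := Nat.le_ceil _
  have hG2 : (G : ℝ) ≤ 2 * (q ^ (J + 1) * F) := by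
    have h1 := Nat.ceil_lt_add_one (show 0 ≤ q ^ (J + 1) * F by positivity)
    have h2 : (1 : ℝ) ≤ (K : ℝ) ^ E := one_le_pow₀ hK1
    linarith
  have hNF : F / 4 ≤ N := by
    have h1 := Nat.lt_floor_add_one F
    change F < (logLogFloor K : ℝ) + 1 at h1
    rw [hN, Nat.cast_sub (by omega)]
    push_cast
    linarith
  refine ⟨K, N, G, ?_, partialSum_logLogFloor_le (by omega), by omega, ?_, ?_, hβK, ?_⟩
  · have h1 : (K : ℝ) ^ δ ≤ (K : ℝ) ^ (1 / 2 : ℝ) := Real.rpow_le_rpow_of_exponent_le hK1 hδ1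
    have h2 : (K : ℝ) ^ (1 / 2 : ℝ) * (K : ℝ) ^ (1 / 2 : ℝ) = K := by
      rw [← Real.rpow_add hK0]
      norm_num
    have h3 : (3 : ℝ) ≤ (K : ℝ) ^ (1 / 2 : ℝ) := by
      have : (0 : ℝ) ≤ 4 * (E * 2 ^ (J + 2) * 3 ^ E) := by positivity
      linarith
    have : (A : ℝ) ≤ K := by nlinarith
    exact_mod_cast this
  · have : ((K ^ E : ℕ) : ℝ) ≤ G := by
      push_cast
      exact hEG.trans hGle
    exact_mod_cast this
  · have h1 : (A : ℝ) ^ E ≤ 3 ^ E * (K : ℝ) ^ (1 / 16 : ℝ) := by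
      calc (A : ℝ) ^ E ≤ (3 * (K : ℝ) ^ δ) ^ E := by gcongr
        _ = 3 ^ E * (K : ℝ) ^ (δ * E) := by rw [mul_pow, ← Real.rpow_mul_natCast hK0.le]
        _ ≤ _ := by gcongr
    have h2 : (E : ℝ) * G * (A : ℝ) ^ E * (K : ℝ) ^ J ≤ N := by
      set c₀ : ℝ := E * 2 ^ (J + 2) * 3 ^ E with hc₀
      have hc₀0 : 0 ≤ c₀ := by positivity
      have hpow : (K : ℝ) ^ (1 / 4 - (J + 1 : ℕ) : ℝ) * (K : ℝ) ^ (1 / 16 : ℝ) * (K : ℝ) ^ J ≤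
          (K : ℝ) ^ (-(1 / 2) : ℝ) := by
        rw [← Real.rpow_natCast (K : ℝ) J, ← Real.rpow_add hK0, ← Real.rpow_add hK0]
        refine Real.rpow_le_rpow_of_exponent_le hK1 ?_
        push_cast
        linarith
      have hcK : c₀ * (K : ℝ) ^ (-(1 / 2) : ℝ) ≤ 1 / 4 := by
        rw [Real.rpow_neg hK0.le, ← div_eq_mul_inv, div_le_iff₀ (by positivity)]
        linarith
      calc (E : ℝ) * G * (A : ℝ) ^ E * (K : ℝ) ^ J
          ≤ E * (2 * (q ^ (J + 1) * F)) * (3 ^ E * (K : ℝ) ^ (1 / 16 : ℝ)) * (K : ℝ) ^ J := by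
            gcongr
        _ = c₀ * ((K : ℝ) ^ (1 / 4 - (J + 1 : ℕ) : ℝ) * (K : ℝ) ^ (1 / 16 : ℝ) * (K : ℝ) ^ J) *
            F := by
            rw [hqJ, hc₀]
            ring
        _ ≤ c₀ * (K : ℝ) ^ (-(1 / 2) : ℝ) * F := by gcongr
        _ ≤ 1 / 4 * F := by gcongr
        _ ≤ N := by linarith
    exact_mod_cast h2
  · intro x hx
    have hc : ∀ m, m ≤ logLogFloor (m + 3) + 27 := fun m ↦ by
      rcases le_or_gt m 27 with h | h
      · omega
      · have := le_logLogFloor (show 27 ≤ m + 3 by omega)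
        omega
    obtain ⟨t, ht, htx, hxt⟩ := exists_coeff_pow_ne_zero_near (g := countSeries fun m ↦
        logLogFloor (m + 3)) (N := N) (B := F ^ (1 - η)) (by positivity) hq0 hq1 (fun y hy ↦ by
      obtain ⟨s, hs, hsy, h⟩ := hnear y (by omega)
      refine ⟨s, ?_, hsy, h⟩
      rcases hs with rfl | ⟨m, rfl⟩
      · exact coeff_zero_countSeries_ne_zero _
      · exact coeff_countSeries_ne_zero (s := fun m ↦ logLogFloor (m + 3)) hc m) (J + 1) x hx
    refine ⟨t, ht, htx, ?_⟩
    have h1 : (x : ℝ) ≤ F := by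
      have h2 : (logLogFloor K : ℝ) ≤ F := Nat.floor_le hF0.le
      have h3 : (x : ℝ) ≤ logLogFloor K := by exact_mod_cast (by omega : x ≤ logLogFloor K)
      linarith
    have h2 : max (F ^ (1 - η)) (q ^ (J + 1) * x) ≤ G :=
      max_le (hηF.trans hGle) (le_trans (by gcongr) hGle)
    have h3 : (x : ℝ) ≤ t + G := by linarith
    exact_mod_cast h3

/-! ### Assembly of the main theorem -/

theorem logTerm_eq {β : ℝ} (m : ℕ) : logTerm β (m + 1) = β⁻¹ ^ logFloor (m + 1) := by
  rw [logTerm, logFloor, ← Int.natCast_floor_eq_floor (by positivity), zpow_neg, zpow_natCast,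
    inv_pow]

theorem logLogTerm_eq {β : ℝ} (m : ℕ) : logLogTerm β (m + 3) = β⁻¹ ^ logLogFloor (m + 3) := by
  rw [logLogTerm, logLogFloor, ← Int.natCast_floor_eq_floor (by positivity), zpow_neg,
    zpow_natCast, inv_pow]

theorem le_logFloor_add (m : ℕ) : m ≤ logFloor (m + 1) + 27 := by
  rcases le_or_gt m 27 with h | h
  · omega
  · have := le_logFloor (show 3 ≤ m + 1 by omega)
    omega

theorem le_logLogFloor_add (m : ℕ) : m ≤ logLogFloor (m + 3) + 27 := by
  rcases le_or_gt m 27 with h | h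
  · omega
  · have := le_logLogFloor (show 27 ≤ m + 3 by omega)
    omega

theorem partialSum_countSeries_le_mul {s : ℕ → ℕ} {c : ℕ} (hs : ∀ m, m ≤ s m + c) (N : ℕ) :
    partialSum (countSeries s) N ≤ (c + 2) * (N + 1) := by
  have := partialSum_countSeries_le (s := s) (N := N) (M := N + c + 1) fun m hm ↦ by
    have := hs m
    omega
  nlinarith

/-- For a Pisot or Salem number `β`, both series (over `m ≥ 1` and `m ≥ 3` respectively) converge
and their sums are algebraically independent over `ℚ`. -/
theorem mainTheorem3 (β : ℝ) (hβ : IsPisotNumber β ∨ IsSalemNumber β) :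
    Summable (fun m : ℕ => logTerm β (m + 1)) ∧
      Summable (fun m : ℕ => logLogTerm β (m + 3)) ∧
      AlgebraicIndependent ℚ
        ![∑' m : ℕ, logTerm β (m + 1), ∑' m : ℕ, logLogTerm β (m + 3)] := by
  obtain ⟨hint, hβ1, hconj⟩ : IsIntegral ℤ β ∧ 1 < β ∧
      ∀ z : ℂ, IsConjRoot ℚ (β : ℂ) z → z ≠ (β : ℂ) → ‖z‖ ≤ 1 := by
    rcases hβ with h | h
    · exact ⟨h.1, h.2.1, fun z hz hne ↦ (h.2.2 z hz hne).le⟩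
    · exact ⟨h.1, h.2.1, h.2.2.1⟩
  obtain ⟨d, hd⟩ := exists_one_le_abs_sum_mul_pow hint hconj
  have hx0 : 0 ≤ β⁻¹ := by positivity
  have hx1 : β⁻¹ < 1 := inv_lt_one_of_one_lt₀ hβ1
  obtain ⟨hf, hfξ⟩ := hasSum_countSeries (s := fun m ↦ logFloor (m + 1)) le_logFloor_add hx0 hx1
  obtain ⟨hg, hgξ⟩ := hasSum_countSeries (s := fun m ↦ logLogFloor (m + 3)) le_logLogFloor_add
    hx0 hx1
  simp only [logTerm_eq, logLogTerm_eq]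
  refine ⟨hf, hg, ?_⟩
  set a := ∑' m : ℕ, β⁻¹ ^ logFloor (m + 1) with ha
  set b := ∑' m : ℕ, β⁻¹ ^ logLogFloor (m + 3) with hb
  -- Since ℚ is algebraic over ℤ, a relation with integer coefficients is all that has to be
  -- excluded.
  have : Algebra.IsAlgebraic ℤ ℚ := IsLocalization.isAlgebraic ℚ (nonZeroDivisors ℤ)
  suffices h : AlgebraicIndependent ℤ ![a, b] from h.extendScalars ℚ
  rw [algebraicIndependent_iff]
  intro P hP
  by_contra hP0
  -- pass to the variables `1 + a` and `1 + b`, and make every monomial divisible by both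
  let ξ : Fin 2 → ℝ := ![1 + a, 1 + b]
  let P' : MvPolynomial (Fin 2) ℤ := MvPolynomial.aeval (fun i ↦ MvPolynomial.X i - 1) P
  have hP'0 : P' ≠ 0 := fun h ↦ by
    have h1 : MvPolynomial.aeval (fun i : Fin 2 ↦ (MvPolynomial.X i + 1 : MvPolynomial (Fin 2) ℤ))
        P' = P := by
      rw [← AlgHom.comp_apply, MvPolynomial.comp_aeval]
      simp
    rw [h, map_zero] at h1
    exact hP0 h1.symm
  have hP'ξ : MvPolynomial.aeval ξ P' = 0 := by
    rw [← AlgHom.comp_apply, MvPolynomial.comp_aeval, ← hP]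
    congr 2
    ext i
    fin_cases i <;> simp [ξ]
  let e : Fin 2 →₀ ℕ := Finsupp.single 0 1 + Finsupp.single 1 1
  refine aeval_ne_zero_of_sparse (ξ := ξ) (C := 29) hβ1 hd (coeff_zero_countSeries_ne_zero _)
    (coeff_zero_countSeries_ne_zero _) (partialSum_countSeries_le_mul le_logFloor_add)
    (partialSum_countSeries_le_mul le_logLogFloor_add) hfξ hgξ ?_ (exists_scale hβ1)
    (P := P' * MvPolynomial.monomial e 1) (mul_ne_zero hP'0 (by simp)) (fun m hm ↦ ?_)
    (by rw [map_mul, hP'ξ, zero_mul])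
  · obtain ⟨y₀, hy₀⟩ := exists_logFloor_mem
    refine ⟨y₀, fun y hy ↦ ?_⟩
    obtain ⟨m, hm⟩ := hy₀ y hy
    exact ⟨_, coeff_countSeries_ne_zero (s := fun m ↦ logFloor (m + 1)) le_logFloor_add m, hm⟩
  · rw [MvPolynomial.mem_support_iff, MvPolynomial.coeff_mul_monomial'] at hm
    have hem : e ≤ m := by
      by_contra h
      exact hm (if_neg h)
    have h0 := hem 0
    have h1 := hem 1
    simp [e] at h0 h1
    omega
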